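/- **Theorem 2.1.** Let $z:[-1/e,\infty)\to[1/e,\infty)$ be the inverse of the function $z\mapsto z\log z$, $z\ge 1/e$. Put $s(2)=e$ and $s(m)=m(\log m)^2$ for $m\ge 3$. For integers $n\ge 2$ and real $x>0$ let $w_n(x)=1-\frac{n}{x}-\frac{n-1}{\log n}\,\frac{\log x}{x}$, and let $$\kappa_m=\frac1m\sum_{\substack{p\le (m+1)/2\\ p\ \mathrm{prime}}}\ \min_{0\le j\le m}\left\{\left\lfloor\frac jp\right\rfloor+\left\lfloor\frac{m-j}p\right\rfloor\right\}\frac{\log p}{p-1}\,w_p\!\left(s(m)e^{s(m)}\right).$$ For $m\ge 5$ put $$d=\left(m+\tfrac12\right)\log m-(1+\kappa_m)m-0.02394,$$ $$B=m^2\log m-(1+\kappa_m)m^2+(m+1)\log(m+1)+\tfrac12 m\log m-(1.02394+\kappa_m)m+0.0000525,$$ $$D=(m+1)\log(m+1)-\kappa_m m+0.0000525+\frac{m}{e^{s(m)}},$$ and for $m=2,3,4$ put respectively $(d,B,D)=(0.3654,\,2.4099,\,3.8111)$, $(0.5139,\,3.6433,\,5.1819)$, $(1.6016,\,9.7676,\,7.3631)$.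 Let $m\ge 2$ be an integer and let $H>0$ be a real number with $\log H\ge s(m)e^{s(m)}$. Let $\mathbb I\subset\mathbb C$ be an imaginary quadratic field with ring of integers $\mathbb Z_{\mathbb I}$. Then for all $(\lambda_0,\lambda_1,\dots,\lambda_m)\in\mathbb Z_{\mathbb I}^{m+1}\setminus\{0\}$ with $\max_{1\le j\le m}|\lambda_j|\le H$, $$\left|\lambda_0+\lambda_1e+\dots+\lambda_me^m\right|>\frac1{2e^{D}}\,(2H)^{-m-\epsilon(H)},$$ where $$\epsilon(H)\log(2H)=B\,z\!\left(\frac{\log(2H)}{1-\frac{d}{s(m)}}\right)+m\log\left(z\!\left(\frac{\log(2H)}{1-\frac{d}{s(m)}}\right)\right).$$ -/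

import Mathlib

namespace TranscendenceE

noncomputable section

/-- The inverse `z : [-1/e, ∞) → [1/e, ∞)` of the function `z ↦ z log z`, `z ≥ 1/e`
(an arbitrary value is taken outside `[-1/e, ∞)`; see `zInv_spec` and `zInv_mul_log`). -/
def zInv : ℝ → ℝ :=
  Function.invFunOn (fun z : ℝ => z * Real.log z) (Set.Ici (Real.exp (-1)))

/-- `zInv` is a right inverse on `[-1/e, ∞)`, with values in `[1/e, ∞)`. -/
theorem zInv_spec {y : ℝ} (hy : -Real.exp (-1) ≤ y) :
    Real.exp (-1) ≤ zInv y ∧ zInv y * Real.log (zInv y) = y := by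
  have hex : ∃ z ∈ Set.Ici (Real.exp (-1)), (fun z : ℝ => z * Real.log z) z = y := by
    have h0 : (fun z : ℝ => z * Real.log z) (Real.exp (-1)) ≤ y := by simpa using hy
    have hb : Real.exp (-1) ≤ max (Real.exp 1) y :=
      le_max_of_le_left (Real.exp_le_exp.mpr (by norm_num))
    have h1 : y ≤ (fun z : ℝ => z * Real.log z) (max (Real.exp 1) y) := by
      have he : Real.exp 1 ≤ max (Real.exp 1) y := le_max_left _ _
      have hpos : 0 < max (Real.exp 1) y := lt_of_lt_of_le (Real.exp_pos 1) he
      have hl : 1 ≤ Real.log (max (Real.exp 1) y) := by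
        rw [Real.le_log_iff_exp_le hpos]
        exact he
      have hm : y ≤ max (Real.exp 1) y := le_max_right _ _
      show y ≤ max (Real.exp 1) y * Real.log (max (Real.exp 1) y)
      nlinarith
    obtain ⟨z, hz, hzy⟩ :=
      intermediate_value_Icc hb Real.continuous_mul_log.continuousOn ⟨h0, h1⟩
    exact ⟨z, hz.1, hzy⟩
  exact ⟨Function.invFunOn_mem hex, Function.invFunOn_eq hex⟩

/-- `zInv` is a left inverse on `[1/e, ∞)`. -/
theorem zInv_mul_log {z : ℝ} (hz : Real.exp (-1) ≤ z) : zInv (z * Real.log z) = z :=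
  Real.mul_log_strictMonoOn.injOn.leftInvOn_invFunOn hz

/-- `s(2) = e` and `s(m) = m (log m)²` for `m ≥ 3`. -/
def s (m : ℕ) : ℝ :=
  if m = 2 then Real.exp 1 else m * Real.log m ^ 2

/-- `w_n(x) = 1 - n/x - ((n - 1)/log n) (log x / x)`. -/
def w (n : ℕ) (x : ℝ) : ℝ :=
  1 - n / x - (n - 1) / Real.log n * (Real.log x / x)

/-- The minimum over `0 ≤ j ≤ m` of `⌊j/p⌋ + ⌊(m - j)/p⌋`. -/
def minFloor (m p : ℕ) : ℕ :=
  (Finset.range (m + 1)).inf' Finset.nonempty_range_add_one (fun j => j / p + (m - j) / p)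

/-- The number `κ_m`, a sum over the primes `p ≤ (m + 1)/2`. -/
def kappa (m : ℕ) : ℝ :=
  1 / m * ∑ p ∈ (Finset.Icc 1 ((m + 1) / 2)).filter Nat.Prime,
    (minFloor m p : ℝ) * (Real.log p / (p - 1)) * w p (s m * Real.exp (s m))

/-- The constant `d(m)`, `m ≥ 2`. -/
def d (m : ℕ) : ℝ :=
  if m = 2 then 0.3654
  else if m = 3 then 0.5139
  else if m = 4 then 1.6016
  else (m + 1 / 2) * Real.log m - (1 + kappa m) * m - 0.02394

/-- The constant `B(m)`, `m ≥ 2`. -/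
def B (m : ℕ) : ℝ :=
  if m = 2 then 2.4099
  else if m = 3 then 3.6433
  else if m = 4 then 9.7676
  else m ^ 2 * Real.log m - (1 + kappa m) * m ^ 2 + (m + 1) * Real.log (m + 1)
    + 1 / 2 * m * Real.log m - (1.02394 + kappa m) * m + 0.0000525

/-- The constant `D(m)`, `m ≥ 2`. -/
def D (m : ℕ) : ℝ :=
  if m = 2 then 3.8111
  else if m = 3 then 5.1819
  else if m = 4 then 7.3631
  else (m + 1) * Real.log (m + 1) - kappa m * m + 0.0000525 + m / Real.exp (s m)

/-- The number `ε(H)`, defined by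
`ε(H) log (2H) = B z(log (2H)/(1 - d/s(m))) + m log z(log (2H)/(1 - d/s(m)))`. -/
def eps (m : ℕ) (H : ℝ) : ℝ :=
  (B m * zInv (Real.log (2 * H) / (1 - d m / s m))
    + m * Real.log (zInv (Real.log (2 * H) / (1 - d m / s m)))) / Real.log (2 * H)

end

end TranscendenceE

/-!
The proof is Hermite's method with the approximations of Hermite and Padé, made explicit.

For a polynomial `f` put `F = f + f' + f'' + ⋯`, so that `e^j F(0) - F(j) = e^j ∫_0^j e^{-x} f(x) dx`.
Take `f = Π^n / (X - k)` with `Π = X (X - 1) ⋯ (X - m)` and `0 ≤ k ≤ m`. Three facts are needed.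

* Arithmetic: all `F(j)`, `0 ≤ j ≤ m`, are divisible by `G = (n-1)! ∏_p p^{c_p v_p(n!)}`, where
  `c_p = min_j (⌊j/p⌋ + ⌊(m-j)/p⌋)` (`commonFactor_dvd`). Indeed `F(j) = ∑ h! a_h` for the Taylor
  coefficients `a_h` of `f` at `j`, the condition `M ∣ h! a_h` is multiplicative in `f`, and each
  factor `(X - i)^n` with `i ≡ j` modulo `p` contributes `p^{v_p(n!)}`. The numbers `κ_m` measure
  the size of the product over `p`.
* Nonvanishing: the `m + 1` forms `∑ λ_j F(j)`, `0 ≤ k ≤ m`, have no common zero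
  (`eq_zero_of_forall_sumIDeriv`).
* Size: `|F(0)|` is at most `2 ((m+1)n - 1)!`, and `∑_j |e^j F(0) - F(j)|` is at most a constant
  times `(max_{[0,m]} |Π|)^{n-1}`.

For a suitable `k` the number `∑ λ_j F(j) / G` is a nonzero integer of an imaginary quadratic field,
hence of absolute value at least `1`; if `n` is so large that the remainders contribute at most
`1/2`, this gives `|Λ| ≥ G / (2 |F(0)|)` (`commonFactor_le_mul_norm`). The least admissible `n` is
essentially the solution of `n log n - d n = log (2H)`, and Stirling's formula turns the bound into
the asserted one (`lower_bound_of_parameters`).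

It remains to verify numerical inequalities. For `m ≥ 6` the constants `d` and `B` leave enough
room, as `max |Π| ≤ (m!/5!) max |x (x - 1) ⋯ (x - 5)|`. For `m = 3, 4` a slightly larger constant
`d'` replaces `d` in the choice of `n`. For `m = 4, 5` use is made of the fact that
`z (log (2H) / (1 - d/s))` exceeds `n - 1` by a constant factor `r > 1`, because `log n` is larger
than `s`; for `m = 3` a factor `r` slightly less than `1` suffices.
-/

namespace TranscendenceE

open Polynomial
open scoped Nat

/-! ### The common factor of the numbers `F(j)` -/

/-- The polynomial `∏_{i ≤ m} (X - i)^{l_i}`, where `l_k = n - 1` and `l_i = n` for `i ≠ k`. -/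
noncomputable def hermitePoly (m n k : ℕ) : ℤ[X] :=
  ∏ i ∈ Finset.range (m + 1), (X - C (i : ℤ)) ^ (if i = k then n - 1 else n)

/-- `M` divides `h! a_h` for every coefficient `a_h` of `f`. -/
def DvdFactorialCoeff (M : ℤ) (f : ℤ[X]) : Prop :=
  ∀ h : ℕ, M ∣ (h ! : ℤ) * f.coeff h

/-- The property is multiplicative because
`h! a_i b_{h-i} = (h choose i) (i! a_i) ((h-i)! b_{h-i})`. -/
theorem DvdFactorialCoeff.mul {M N : ℤ} {f g : ℤ[X]} (hf : DvdFactorialCoeff M f)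
    (hg : DvdFactorialCoeff N g) : DvdFactorialCoeff (M * N) (f * g) := by
  intro h
  rw [coeff_mul, Finset.mul_sum]
  refine Finset.dvd_sum fun x hx => ?_
  have hx : x.1 + x.2 = h := Finset.HasAntidiagonal.mem_antidiagonal.mp hx
  have h1 : (h ! : ℤ) = (h.choose x.1 : ℤ) * x.1 ! * x.2 ! := by
    have := Nat.choose_mul_factorial_mul_factorial (show x.1 ≤ h by omega)
    rw [show h - x.1 = x.2 by omega] at this
    exact_mod_cast this.symm
  have h2 : (h ! : ℤ) * (f.coeff x.1 * g.coeff x.2)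
      = (h.choose x.1 : ℤ) * ((x.1 ! * f.coeff x.1) * (x.2 ! * g.coeff x.2)) := by
    rw [h1]; ring
  rw [h2]
  exact Dvd.dvd.mul_left (mul_dvd_mul (hf _) (hg _)) _

theorem DvdFactorialCoeff.one (f : ℤ[X]) : DvdFactorialCoeff 1 f := fun _ => one_dvd _

theorem DvdFactorialCoeff.prod {ι : Type*} (t : Finset ι) (M : ι → ℤ) (f : ι → ℤ[X])
    (h : ∀ i ∈ t, DvdFactorialCoeff (M i) (f i)) :
    DvdFactorialCoeff (∏ i ∈ t, M i) (∏ i ∈ t, f i) := by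
  classical
  induction t using Finset.induction_on with
  | empty => simpa using DvdFactorialCoeff.one 1
  | insert a t ha ih =>
    rw [Finset.prod_insert ha, Finset.prod_insert ha]
    exact (h a (Finset.mem_insert_self a t)).mul
      (ih fun i hi => h i (Finset.mem_insert_of_mem hi))

/-- If `p ∣ u`, the coefficients of `(X + u)^l` satisfy
`h! (l choose h) u^(l-h) = l! u^(l-h) / (l-h)!`, and `v_p((l-h)!) ≤ l - h`. -/
theorem dvdFactorialCoeff_X_add_pow {p : ℕ} (hp : p.Prime) {u : ℤ} (hu : (p : ℤ) ∣ u) (l : ℕ) :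
    DvdFactorialCoeff ((p : ℤ) ^ padicValNat p (l !)) ((X + C u) ^ l) := by
  intro h
  have := Fact.mk hp
  rw [coeff_X_add_C_pow]
  rcases lt_or_ge l h with hl | hl
  · simp [Nat.choose_eq_zero_of_lt hl]
  have h1 : ((h ! : ℤ) * (l.choose h)) * ((l - h)! : ℤ) = (l ! : ℤ) := by
    have := Nat.choose_mul_factorial_mul_factorial hl
    rw [← this]; push_cast; ring
  have hv : padicValNat p ((l - h)!) ≤ l - h := by
    have := sub_one_mul_padicValNat_factorial (p := p) (l - h)
    have h2 := hp.two_le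
    have h3 : padicValNat p ((l - h)!) ≤ (p - 1) * padicValNat p ((l - h)!) :=
      Nat.le_mul_of_pos_left _ (by omega)
    omega
  have h4 : padicValNat p (l !) ≤ padicValNat p (h ! * l.choose h) + (l - h) := by
    have h5 : h ! * l.choose h * (l - h)! = l ! := by exact_mod_cast h1
    have h6 : h ! * l.choose h ≠ 0 :=
      mul_ne_zero (Nat.factorial_ne_zero _) (Nat.choose_pos hl).ne'
    rw [← h5, padicValNat.mul h6 (Nat.factorial_ne_zero _)]
    omega
  have h7 : (p : ℤ) ^ padicValNat p (h ! * l.choose h) ∣ (h ! : ℤ) * (l.choose h) := by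
    exact_mod_cast (pow_padicValNat_dvd (p := p) (n := h ! * l.choose h))
  calc (p : ℤ) ^ padicValNat p (l !)
      ∣ (p : ℤ) ^ (padicValNat p (h ! * l.choose h) + (l - h)) := pow_dvd_pow _ h4
    _ = (p : ℤ) ^ padicValNat p (h ! * l.choose h) * (p : ℤ) ^ (l - h) := pow_add _ _ _
    _ ∣ ((h ! : ℤ) * (l.choose h)) * u ^ (l - h) := mul_dvd_mul h7 (pow_dvd_pow_of_dvd hu _)
    _ = (h ! : ℤ) * (u ^ (l - h) * (l.choose h)) := by ring

theorem dvd_eval_sumIDeriv {M : ℤ} {f : ℤ[X]} {r : ℤ} (h : DvdFactorialCoeff M (taylor r f)) :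
    M ∣ (sumIDeriv f).eval r := by
  rw [sumIDeriv_apply, eval_finsetSum]
  refine Finset.dvd_sum fun i _ => ?_
  have h1 := h i
  rw [taylor_coeff] at h1
  rw [← factorial_smul_hasseDeriv]
  simpa [LinearMap.smul_apply, nsmul_eq_mul] using h1

/-- Among `0, …, m` there are `⌊j/p⌋ + ⌊(m-j)/p⌋ + 1` integers congruent to `j` modulo `p`. -/
theorem card_congruent_ge {m j p : ℕ} (hp : 0 < p) (hj : j ≤ m) :
    j / p + (m - j) / p + 1 ≤
      ((Finset.range (m + 1)).filter fun i : ℕ => (p : ℤ) ∣ (j : ℤ) - i).card := by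
  have h1 := Nat.div_add_mod j p
  have h2 := Nat.div_mul_le_self (m - j) p
  rw [← Finset.card_range (j / p + (m - j) / p + 1)]
  refine Finset.card_le_card_of_injOn (fun t => j % p + p * t) ?_ ?_
  · intro t ht
    have ht' : t ≤ j / p + (m - j) / p := by
      have := Finset.mem_range.mp (Finset.mem_coe.mp ht); omega
    have h3 : p * t ≤ p * (j / p) + p * ((m - j) / p) := by
      rw [← mul_add]; exact Nat.mul_le_mul_left _ ht'
    have h4 : p * ((m - j) / p) ≤ m - j := by rw [mul_comm]; exact h2
    simp only [Finset.coe_filter, Finset.mem_range, Set.mem_ofPred_eq]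
    refine ⟨by omega, ?_⟩
    have h5 : (j : ℤ) = p * ((j / p : ℕ) : ℤ) + ((j % p : ℕ) : ℤ) := by exact_mod_cast h1.symm
    refine ⟨((j / p : ℕ) : ℤ) - t, ?_⟩
    rw [Nat.cast_add, Nat.cast_mul]
    linear_combination h5
  · intro a _ b _ hab
    have : p * a = p * b := by simpa using hab
    exact Nat.eq_of_mul_eq_mul_left hp this

theorem minFloor_le {m j : ℕ} (p : ℕ) (hj : j ≤ m) : minFloor m p ≤ j / p + (m - j) / p :=
  Finset.inf'_le (fun j => j / p + (m - j) / p) (Finset.mem_range.mpr (by omega))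

theorem taylor_hermitePoly (m n k : ℕ) (r : ℤ) :
    taylor r (hermitePoly m n k) =
      ∏ i ∈ Finset.range (m + 1), (X + C (r - i)) ^ (if i = k then n - 1 else n) := by
  have h : taylor r (hermitePoly m n k) = taylorAlgHom r (hermitePoly m n k) := rfl
  rw [h, hermitePoly, map_prod]
  refine Finset.prod_congr rfl fun i _ => ?_
  rw [map_pow]
  congr 1
  simp only [taylorAlgHom_apply, map_sub, taylor_X, taylor_C]
  ring

/-- At least `minFloor m p + 1` of the integers `0, …, m` are congruent to `j` modulo `p`. Each of them
contributes `v_p(n!)`, except for `k`, which contributes `v_p((n-1)!)`. -/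
theorem prime_pow_dvd_eval_sumIDeriv {p : ℕ} (hp : p.Prime) {m n j : ℕ} (k : ℕ) (hn : 1 ≤ n)
    (hj : j ≤ m) :
    (p : ℤ) ^ (padicValNat p ((n - 1)!) + minFloor m p * padicValNat p (n !)) ∣
      (sumIDeriv (hermitePoly m n k)).eval (j : ℤ) := by
  have := Fact.mk hp
  apply dvd_eval_sumIDeriv
  rw [taylor_hermitePoly]
  set l : ℕ → ℕ := fun i => if i = k then n - 1 else n with hl
  set S := (Finset.range (m + 1)).filter fun i : ℕ => (p : ℤ) ∣ (j : ℤ) - i with hS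
  have key : DvdFactorialCoeff (∏ i ∈ Finset.range (m + 1),
      (if (p : ℤ) ∣ (j : ℤ) - i then (p : ℤ) ^ padicValNat p ((l i)!) else 1))
      (∏ i ∈ Finset.range (m + 1), (X + C ((j : ℤ) - i)) ^ (l i)) := by
    refine DvdFactorialCoeff.prod _ _ _ fun i _ => ?_
    split_ifs with h
    · exact dvdFactorialCoeff_X_add_pow hp h _
    · exact DvdFactorialCoeff.one _
  rw [← Finset.prod_filter, Finset.prod_pow_eq_pow_sum] at key
  have hmono : padicValNat p ((n - 1)!) ≤ padicValNat p (n !) := by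
    apply (padicValNat_dvd_iff_le (Nat.factorial_ne_zero n)).mp
    exact pow_padicValNat_dvd.trans (Nat.factorial_dvd_factorial (by omega))
  have hcard : minFloor m p + 1 ≤ S.card :=
    (Nat.succ_le_succ (minFloor_le p hj)).trans (card_congruent_ge hp.pos hj)
  have hsum : padicValNat p ((n - 1)!) + (S.card - 1) * padicValNat p (n !) ≤
      ∑ i ∈ S, padicValNat p ((l i)!) := by
    by_cases hk : k ∈ S
    · rw [← Finset.add_sum_erase _ _ hk]
      have h1 : ∑ i ∈ S.erase k, padicValNat p ((l i)!) = (S.card - 1) * padicValNat p (n !) := by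
        rw [Finset.sum_congr rfl (g := fun _ => padicValNat p (n !)), Finset.sum_const,
          Finset.card_erase_of_mem hk, smul_eq_mul]
        intro i hi
        simp [hl, Finset.ne_of_mem_erase hi]
      rw [h1]
      simp [hl]
    · have h1 : ∑ i ∈ S, padicValNat p ((l i)!) = S.card * padicValNat p (n !) := by
        rw [Finset.sum_congr rfl (g := fun _ => padicValNat p (n !)), Finset.sum_const, smul_eq_mul]
        intro i hi
        have : i ≠ k := fun h => hk (h ▸ hi)
        simp [hl, this]
      rw [h1]
      obtain ⟨c, hc⟩ : ∃ c, S.card = c + 1 := ⟨S.card - 1, by omega⟩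
      rw [hc, Nat.add_sub_cancel, add_mul, one_mul]
      omega
  intro h
  refine (pow_dvd_pow _ (le_trans ?_ hsum)).trans (key h)
  exact Nat.add_le_add_left (Nat.mul_le_mul_right _ (by omega)) _

/-- The common factor `(n-1)! ∏_p p^{c_p v_p(n!)}` of the numbers `F(j)`, `0 ≤ j ≤ m`, attached to
`hermitePoly m n k`; here `p` runs over the primes `p ≤ (m + 1)/2` and `c_p = minFloor m p`. -/
def commonFactor (m n : ℕ) : ℕ :=
  (n - 1)! * ∏ p ∈ (Finset.Icc 1 ((m + 1) / 2)).filter Nat.Prime,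
    p ^ (minFloor m p * padicValNat p (n !))

theorem commonFactor_pos (m n : ℕ) : 0 < commonFactor m n := by
  refine Nat.mul_pos (Nat.factorial_pos _) (Finset.prod_pos fun p hp => ?_)
  exact pow_pos (Finset.mem_filter.mp hp).2.pos _

theorem commonFactor_dvd {m n j : ℕ} (k : ℕ) (hn : 1 ≤ n) (hj : j ≤ m) :
    (commonFactor m n : ℤ) ∣ (sumIDeriv (hermitePoly m n k)).eval (j : ℤ) := by
  rw [Int.natCast_dvd, Nat.dvd_iff_prime_pow_dvd_dvd]
  intro p e hp he
  have := Fact.mk hp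
  have hfac : ∀ q ∈ (Finset.Icc 1 ((m + 1) / 2)).filter Nat.Prime,
      q ^ (minFloor m q * padicValNat q (n !)) ≠ 0 := fun q hq =>
    pow_ne_zero _ (Finset.mem_filter.mp hq).2.ne_zero
  have hval : padicValNat p (commonFactor m n) ≤
      padicValNat p ((n - 1)!) + minFloor m p * padicValNat p (n !) := by
    rw [commonFactor, padicValNat.mul (Nat.factorial_ne_zero _) (Finset.prod_ne_zero_iff.mpr hfac)]
    refine Nat.add_le_add_left ?_ _
    rw [← Nat.factorization_def _ hp, Nat.factorization_prod hfac, Finsupp.finsetSum_apply]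
    calc ∑ q ∈ (Finset.Icc 1 ((m + 1) / 2)).filter Nat.Prime,
          (q ^ (minFloor m q * padicValNat q (n !))).factorization p
        = ∑ q ∈ (Finset.Icc 1 ((m + 1) / 2)).filter Nat.Prime,
          if q = p then minFloor m p * padicValNat p (n !) else 0 := by
          refine Finset.sum_congr rfl fun q hq => ?_
          rw [Nat.Prime.factorization_pow (Finset.mem_filter.mp hq).2, Finsupp.single_apply]
          split_ifs with h
          · rw [h]
          · rfl
      _ ≤ minFloor m p * padicValNat p (n !) := by
          rw [Finset.sum_ite_eq']
          split_ifs <;> simp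
  have h1 : e ≤ padicValNat p (commonFactor m n) :=
    (padicValNat_dvd_iff_le (commonFactor_pos m n).ne').mp he
  have h2 := (pow_dvd_pow (p : ℤ) (h1.trans hval)).trans
    (prime_pow_dvd_eval_sumIDeriv hp k hn hj)
  have h3 : ((p ^ e : ℕ) : ℤ) ∣ (sumIDeriv (hermitePoly m n k)).eval (j : ℤ) := by
    exact_mod_cast h2
  exact Int.natCast_dvd.mp h3

/-! ### Linear independence of the approximating forms -/

section Nonvanishing

variable {F : Type*} [Field F]

/-- The functional `f ↦ ∑_{j ≤ m} a_j F(j)`, where `F = f + f' + f'' + ⋯`. -/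
noncomputable def sumIDerivForm (m : ℕ) (a : ℕ → F) : F[X] →ₗ[F] F :=
  ∑ j ∈ Finset.range (m + 1), a j • (leval (j : F) ∘ₗ (sumIDeriv : F[X] →ₗ[F] F[X]))

theorem sumIDerivForm_apply (m : ℕ) (a : ℕ → F) (f : F[X]) :
    sumIDerivForm m a f = ∑ j ∈ Finset.range (m + 1), a j * (sumIDeriv f).eval (j : F) := by
  simp [sumIDerivForm, leval]

theorem sumIDerivForm_sub_derivative (m : ℕ) (a : ℕ → F) (f : F[X]) :
    sumIDerivForm m a (f - derivative f) =
      ∑ j ∈ Finset.range (m + 1), a j * f.eval (j : F) := by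
  have h : sumIDeriv (f - derivative f) = f := by
    rw [map_sub, sumIDeriv_derivative]
    nth_rw 1 [sumIDeriv_eq_self_add f]
    ring
  rw [sumIDerivForm_apply, h]

/-- The polynomial `X (X - 1) ⋯ (X - m)`. -/
noncomputable def nodePoly (F : Type*) [Field F] (m : ℕ) : F[X] :=
  ∏ i ∈ Finset.range (m + 1), (X - C (i : F))

theorem nodePoly_monic (m : ℕ) : (nodePoly F m).Monic :=
  monic_prod_of_monic _ _ fun _ _ => monic_X_sub_C _

theorem natDegree_nodePoly (m : ℕ) : (nodePoly F m).natDegree = m + 1 := by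
  rw [nodePoly, natDegree_prod_of_monic _ _ fun i _ => monic_X_sub_C _]
  simp only [natDegree_X_sub_C, Finset.sum_const, Finset.card_range, smul_eq_mul, mul_one]

theorem eval_nodePoly {m j : ℕ} (hj : j ∈ Finset.range (m + 1)) :
    (nodePoly F m).eval (j : F) = 0 := by
  rw [nodePoly, eval_prod]
  exact Finset.prod_eq_zero hj (by simp)

theorem isCoprime_nodePoly_derivative [CharZero F] (m : ℕ) :
    IsCoprime (nodePoly F m) (derivative (nodePoly F m)) := by
  have : (nodePoly F m).Separable :=
    separable_prod' (fun x _ y _ hxy => isCoprime_X_sub_C_of_isUnit_sub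
      ((sub_ne_zero.mpr (Nat.cast_injective.ne hxy)).isUnit)) fun x _ => separable_X_sub_C
  exact this

/-- `(1 - d/dX)(Π^{e+1} S)` is killed by the functional, as `Π^{e+1} S` vanishes at `0, …, m`. -/
theorem sumIDerivForm_nodePoly_pow (m : ℕ) (a : ℕ → F) (e : ℕ) (S : F[X]) :
    sumIDerivForm m a (nodePoly F m ^ e * (nodePoly F m * S -
      ((e + 1 : ℕ) : F[X]) * derivative (nodePoly F m) * S - nodePoly F m * derivative S)) = 0 := by
  have h : nodePoly F m ^ e * (nodePoly F m * S -
      ((e + 1 : ℕ) : F[X]) * derivative (nodePoly F m) * S - nodePoly F m * derivative S) =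
      nodePoly F m ^ (e + 1) * S - derivative (nodePoly F m ^ (e + 1) * S) := by
    rw [derivative_mul, derivative_pow_succ]
    simp only [map_add, map_natCast, map_one, Nat.cast_add, Nat.cast_one]
    ring
  rw [h, sumIDerivForm_sub_derivative]
  refine Finset.sum_eq_zero fun j hj => ?_
  simp [eval_nodePoly hj]

/-- A functional that kills `Π^e R` for all `R` of degree at most `m` kills `Π^e R` for all `R`:
the polynomials of `sumIDerivForm_nodePoly_pow` have the same leading term as `Π^e · Π S`. -/
theorem sumIDerivForm_eq_zero_of_lowDegree {m : ℕ} {a : ℕ → F} {e : ℕ}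
    (h : ∀ R : F[X], R.degree < (m + 1 : ℕ) → sumIDerivForm m a (nodePoly F m ^ e * R) = 0)
    (R : F[X]) : sumIDerivForm m a (nodePoly F m ^ e * R) = 0 := by
  have main : ∀ N : ℕ, ∀ R : F[X], R.degree < N →
      sumIDerivForm m a (nodePoly F m ^ e * R) = 0 := by
    intro N
    induction N with
    | zero =>
      intro R hR
      exact h R (hR.trans_le (by exact_mod_cast Nat.zero_le _))
    | succ N ih =>
      intro R hR
      rcases Nat.lt_or_ge N (m + 1) with hN | hN
      · exact h R (hR.trans_le (by exact_mod_cast hN))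
      set P := nodePoly F m with hP
      have hmon : P.Monic := nodePoly_monic m
      have hdegP : P.degree = (m + 1 : ℕ) := by
        rw [degree_eq_natDegree hmon.ne_zero, natDegree_nodePoly]
      have hdiv := modByMonic_add_div R P
      set T := R %ₘ P
      set S := R /ₘ P
      have hT : T.degree < (N : ℕ) := by
        have h1 : T.degree < P.degree := degree_modByMonic_lt R hmon
        rw [hdegP] at h1
        exact h1.trans_le (by exact_mod_cast hN)
      have hPS : (P * S).degree < (N + 1 : ℕ) := by
        have h1 : P * S = R - T := by rw [← hdiv]; ring
        rw [h1]
        refine (degree_sub_le _ _).trans_lt (max_lt hR (hT.trans ?_))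
        exact_mod_cast Nat.lt_succ_self N
      have hrec : sumIDerivForm m a (P ^ e * (T + ((e + 1 : ℕ) : F[X]) * derivative P * S
          + P * derivative S)) = 0 := by
        apply ih
        by_cases hS : S = 0
        · simpa [hS] using hT
        have hdegS : P.natDegree + S.natDegree ≤ N := by
          have h1 : (P * S).natDegree < N + 1 :=
            (natDegree_lt_iff_degree_lt (mul_ne_zero hmon.ne_zero hS)).mpr hPS
          rw [natDegree_mul hmon.ne_zero hS] at h1
          omega
        have hPd : P.natDegree = m + 1 := natDegree_nodePoly m
        have hlt : ∀ Q : F[X], Q.natDegree < N → Q.degree < (N : ℕ) := fun Q hQ =>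
          (degree_le_natDegree).trans_lt (by exact_mod_cast hQ)
        have h1 : (((e + 1 : ℕ) : F[X]) * derivative P * S).degree < (N : ℕ) := by
          apply hlt
          have h2 := natDegree_mul_le (p := ((e + 1 : ℕ) : F[X]) * derivative P) (q := S)
          have h3 := natDegree_mul_le (p := ((e + 1 : ℕ) : F[X])) (q := derivative P)
          have h4 := natDegree_derivative_lt (p := P) (by omega)
          rw [natDegree_natCast] at h3
          omega
        have h2 : (P * derivative S).degree < (N : ℕ) := by
          by_cases hS0 : S.natDegree = 0
          · rw [natDegree_eq_zero.mp hS0 |>.choose_spec.symm]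
            simp only [derivative_C, mul_zero, degree_zero]
            exact WithBot.bot_lt_coe N
          · apply hlt
            have h3 := natDegree_mul_le (p := P) (q := derivative S)
            have h4 := natDegree_derivative_lt hS0
            omega
        exact (degree_add_le _ _).trans_lt (max_lt
          ((degree_add_le _ _).trans_lt (max_lt hT h1)) h2)
      have hz := sumIDerivForm_nodePoly_pow m a e S
      have hsplit : P ^ e * R = P ^ e * (T + ((e + 1 : ℕ) : F[X]) * derivative P * S
          + P * derivative S) + P ^ e * (P * S - ((e + 1 : ℕ) : F[X]) * derivative P * S
          - P * derivative S) := by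
        rw [← hdiv]; ring
      rw [hsplit, map_add, hrec, zero_add]
      exact hz
  exact main (R.natDegree + 1) R (degree_le_natDegree.trans_lt
    (by exact_mod_cast Nat.lt_succ_self _))

/-- As `Π` and `Π'` are coprime, vanishing on all multiples of `Π^e` descends to all
polynomials. -/
theorem sumIDerivForm_eq_zero_of_nodePoly_pow [CharZero F] {m : ℕ} {a : ℕ → F} {e : ℕ}
    (h : ∀ R : F[X], sumIDerivForm m a (nodePoly F m ^ e * R) = 0) (R : F[X]) :
    sumIDerivForm m a R = 0 := by
  induction e generalizing R with
  | zero => simpa using h R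
  | succ e ih =>
    refine ih (fun R => ?_) R
    obtain ⟨u, v, huv⟩ := isCoprime_nodePoly_derivative (F := F) m
    set P := nodePoly F m with hP
    set c : F := ((e + 1 : ℕ) : F) with hc
    have hc0 : c ≠ 0 := Nat.cast_ne_zero.mpr (Nat.succ_ne_zero e)
    set S := C c⁻¹ * (v * R) with hS
    have hcS : ((e + 1 : ℕ) : F[X]) * S = v * R := by
      have : ((e + 1 : ℕ) : F[X]) = C c := by simp [hc]
      rw [this, hS, ← mul_assoc, ← C_mul, mul_inv_cancel₀ hc0, C_1, one_mul]
    have hsplit : P ^ e * R = P ^ (e + 1) * (u * R + S - derivative S) - P ^ e *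
        (P * S - ((e + 1 : ℕ) : F[X]) * derivative P * S - P * derivative S) := by
      linear_combination (-(P ^ e * R)) * huv - P ^ e * derivative P * hcS
    rw [hsplit, map_sub, h, sumIDerivForm_nodePoly_pow, sub_zero]

/-- The linear forms attached to the polynomials `Π^n / (X - k)`, `0 ≤ k ≤ m`, are linearly
independent. -/
theorem eq_zero_of_forall_sumIDeriv [CharZero F] {m n : ℕ} (hn : 1 ≤ n) {a : ℕ → F}
    (h : ∀ k ≤ m, ∑ j ∈ Finset.range (m + 1), a j *
      (sumIDeriv ((hermitePoly m n k).map (Int.castRingHom F))).eval (j : F) = 0) :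
    ∀ j ≤ m, a j = 0 := by
  have hmap : ∀ k ∈ Finset.range (m + 1), (hermitePoly m n k).map (Int.castRingHom F) =
      nodePoly F m ^ (n - 1) * ∏ i ∈ (Finset.range (m + 1)).erase k, (X - C (i : F)) := by
    intro k hk
    rw [hermitePoly, Polynomial.map_prod, nodePoly, ← Finset.mul_prod_erase _ _ hk,
      ← Finset.mul_prod_erase _ (fun i : ℕ => X - C (i : F)) hk, mul_pow, mul_assoc,
      ← Finset.prod_pow, ← Finset.prod_mul_distrib]
    congr 1
    · simp
    · refine Finset.prod_congr rfl fun i hi => ?_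
      rw [if_neg (Finset.ne_of_mem_erase hi), ← pow_succ, Nat.sub_add_cancel hn]
      simp
  have hlow : ∀ R : F[X], R.degree < (m + 1 : ℕ) →
      sumIDerivForm m a (nodePoly F m ^ (n - 1) * R) = 0 := by
    intro R hR
    have hinj : Set.InjOn (fun i : ℕ => (i : F)) (Finset.range (m + 1)) :=
      Nat.cast_injective.injOn
    rw [Lagrange.eq_interpolate hinj (f := R) (by simpa using hR), Lagrange.interpolate_apply,
      Finset.mul_sum, map_sum]
    refine Finset.sum_eq_zero fun k hk => ?_
    have hb : Lagrange.basis (Finset.range (m + 1)) (fun i : ℕ => (i : F)) k =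
        C (∏ i ∈ (Finset.range (m + 1)).erase k, ((k : F) - i)⁻¹) *
          ∏ i ∈ (Finset.range (m + 1)).erase k, (X - C (i : F)) := by
      rw [Lagrange.basis, map_prod, ← Finset.prod_mul_distrib]
      rfl
    have h0 := h k (Nat.lt_succ_iff.mp (Finset.mem_range.mp hk))
    rw [← sumIDerivForm_apply, hmap k hk] at h0
    rw [hb, ← mul_assoc (C _), ← C_mul, mul_left_comm, ← smul_eq_C_mul, map_smul, h0, smul_zero]
  have hall := fun Q => sumIDerivForm_eq_zero_of_nodePoly_pow
    (sumIDerivForm_eq_zero_of_lowDegree hlow) Q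
  intro j hj
  have hj' : j ∈ Finset.range (m + 1) := Finset.mem_range.mpr (by omega)
  set Q : F[X] := ∏ i ∈ (Finset.range (m + 1)).erase j, (X - C (i : F)) with hQ
  have h1 := hall (Q - derivative Q)
  rw [sumIDerivForm_sub_derivative, Finset.sum_eq_single j] at h1
  · refine (mul_eq_zero.mp h1).resolve_right ?_
    rw [hQ, eval_prod, ← ne_eq, Finset.prod_ne_zero_iff]
    intro i hi
    simpa [sub_eq_zero] using (Finset.ne_of_mem_erase hi).symm
  · intro i hi hij
    rw [hQ, eval_prod, Finset.prod_eq_zero (Finset.mem_erase.mpr ⟨hij, hi⟩) (by simp), mul_zero]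
  · exact fun h => absurd hj' h

end Nonvanishing

/-! ### Estimates for `F(0)` and for the remainders -/

/-- The derivative of `e^{-x} F(x)`, `F = f + f' + ⋯`, is `-e^{-x} f(x)`; hence it decreases where
`f` is nonnegative. -/
theorem eval_sumIDeriv_le_exp_mul {f : ℝ[X]} {t : ℝ} (ht : 0 ≤ t)
    (hf : ∀ x, 0 ≤ x → x ≤ t → 0 ≤ f.eval x) :
    (sumIDeriv f).eval t ≤ Real.exp t * (sumIDeriv f).eval 0 := by
  have hderiv : ∀ x : ℝ, HasDerivAt (fun x => Real.exp (-x) * (sumIDeriv f).eval x)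
      (-(Real.exp (-x) * f.eval x)) x := by
    intro x
    have h1 : HasDerivAt (fun x : ℝ => Real.exp (-x)) (Real.exp (-x) * (-1)) x :=
      (hasDerivAt_neg x).exp
    have h2 := h1.mul ((sumIDeriv f).hasDerivAt x)
    convert! h2 using 1
    have h3 := congrArg (eval x) (sumIDeriv_eq_self_add f)
    rw [eval_add] at h3
    rw [h3]
    ring
  have hanti : AntitoneOn (fun x => Real.exp (-x) * (sumIDeriv f).eval x) (Set.Icc 0 t) := by
    refine antitoneOn_of_deriv_nonpos (convex_Icc 0 t)
      (fun x _ => (hderiv x).continuousAt.continuousWithinAt)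
      (fun x _ => (hderiv x).differentiableAt.differentiableWithinAt) fun x hx => ?_
    rw [interior_Icc] at hx
    rw [(hderiv x).deriv]
    exact neg_nonpos.mpr (mul_nonneg (Real.exp_pos _).le (hf x hx.1.le hx.2.le))
  have h := hanti (Set.left_mem_Icc.mpr ht) (Set.right_mem_Icc.mpr ht) ht
  simp only [neg_zero, Real.exp_zero, one_mul] at h
  calc (sumIDeriv f).eval t = Real.exp t * (Real.exp (-t) * (sumIDeriv f).eval t) := by
        rw [← mul_assoc, ← Real.exp_add]; simp
    _ ≤ _ := mul_le_mul_of_nonneg_left h (Real.exp_pos _).le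

theorem eval_zero_sumIDeriv_nonneg {f : ℝ[X]} (hf : ∀ x, 0 ≤ x → 0 ≤ f.eval x) :
    0 ≤ (sumIDeriv f).eval 0 := by
  have h := (sumIDeriv f).tendsto_div_exp_atTop
  refine le_of_tendsto h ?_
  filter_upwards [Filter.eventually_ge_atTop (0 : ℝ)] with t ht
  rw [div_le_iff₀' (Real.exp_pos t)]
  exact eval_sumIDeriv_le_exp_mul ht fun x hx _ => hf x hx

theorem eval_zero_sumIDeriv_X_pow (N : ℕ) : (sumIDeriv (X ^ N : ℝ[X])).eval 0 = N ! := by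
  induction N with
  | zero =>
    have : (X ^ 0 : ℝ[X]) = C 1 := by simp
    rw [this, sumIDeriv_C]; simp
  | succ N ih =>
    rw [sumIDeriv_eq_self_add, ← sumIDeriv_derivative, derivative_X_pow_succ, ← smul_eq_C_mul,
      map_smul, eval_add, eval_smul, ih, Nat.factorial_succ]
    simp

theorem abs_eval_zero_sumIDeriv_le {f : ℝ[X]} {a : ℝ} {N : ℕ}
    (hf : ∀ x, 0 ≤ x → |f.eval x| ≤ a + x ^ N) :
    |(sumIDeriv f).eval 0| ≤ a + N ! := by
  have h1 := eval_zero_sumIDeriv_nonneg (f := C a + X ^ N - f) fun x hx => by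
    have := (abs_le.mp (hf x hx)).2
    simp; linarith
  have h2 := eval_zero_sumIDeriv_nonneg (f := C a + X ^ N + f) fun x hx => by
    have := (abs_le.mp (hf x hx)).1
    simp; linarith
  simp only [map_sub, map_add, sumIDeriv_C, eval_sub, eval_add, eval_C,
    eval_zero_sumIDeriv_X_pow] at h1 h2
  exact abs_le.mpr ⟨by linarith, by linarith⟩

theorem abs_exp_mul_sumIDeriv_sub_le {f : ℝ[X]} {t a : ℝ} (ht : 0 ≤ t)
    (hf : ∀ x, 0 ≤ x → x ≤ t → |f.eval x| ≤ a) :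
    |Real.exp t * (sumIDeriv f).eval 0 - (sumIDeriv f).eval t| ≤ (Real.exp t - 1) * a := by
  have h1 := eval_sumIDeriv_le_exp_mul (f := C a - f) ht fun x hx hxt => by
    have := (abs_le.mp (hf x hx hxt)).2
    simp; linarith
  have h2 := eval_sumIDeriv_le_exp_mul (f := C a + f) ht fun x hx hxt => by
    have := (abs_le.mp (hf x hx hxt)).1
    simp; linarith
  simp only [map_sub, map_add, sumIDeriv_C, eval_sub, eval_add, eval_C] at h1 h2
  exact abs_le.mpr ⟨by linarith, by linarith⟩

theorem eval_map_hermitePoly (m n k : ℕ) (x : ℝ) :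
    ((hermitePoly m n k).map (Int.castRingHom ℝ)).eval x =
      ∏ i ∈ Finset.range (m + 1), (x - i) ^ (if i = k then n - 1 else n) := by
  rw [hermitePoly, Polynomial.map_prod, eval_prod]
  exact Finset.prod_congr rfl fun i _ => by rw [Polynomial.map_pow, eval_pow]; simp

theorem eval_map_hermitePoly_eq_mul {m n k : ℕ} (hn : 1 ≤ n) (hk : k ≤ m) (x : ℝ) :
    ((hermitePoly m n k).map (Int.castRingHom ℝ)).eval x =
      (∏ i ∈ Finset.range (m + 1), (x - i)) ^ (n - 1) *
        ∏ i ∈ (Finset.range (m + 1)).erase k, (x - i) := by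
  have hk' : k ∈ Finset.range (m + 1) := Finset.mem_range.mpr (by omega)
  rw [eval_map_hermitePoly, ← Finset.mul_prod_erase _ _ hk',
    ← Finset.mul_prod_erase _ (fun i : ℕ => x - (i : ℝ)) hk', mul_pow, mul_assoc,
    ← Finset.prod_pow, ← Finset.prod_mul_distrib]
  congr 1
  · simp
  · refine Finset.prod_congr rfl fun i hi => ?_
    rw [if_neg (Finset.ne_of_mem_erase hi), ← pow_succ, Nat.sub_add_cancel hn]

theorem sum_exponents {m n k : ℕ} (hn : 1 ≤ n) (hk : k ≤ m) :
    ∑ i ∈ Finset.range (m + 1), (if i = k then n - 1 else n) = (m + 1) * n - 1 := by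
  have hk' : k ∈ Finset.range (m + 1) := Finset.mem_range.mpr (by omega)
  rw [← Finset.add_sum_erase _ _ hk', if_pos rfl,
    Finset.sum_congr rfl (g := fun _ => n) fun i hi => if_neg (Finset.ne_of_mem_erase hi),
    Finset.sum_const, Finset.card_erase_of_mem hk', Finset.card_range, smul_eq_mul,
    Nat.add_sub_cancel, add_mul, one_mul]
  omega

theorem abs_eval_map_hermitePoly_le {m n k : ℕ} (hn : 1 ≤ n) (hk : k ≤ m) {x : ℝ} (hx : 0 ≤ x) :
    |((hermitePoly m n k).map (Int.castRingHom ℝ)).eval x| ≤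
      (m : ℝ) ^ ((m + 1) * n - 1) + x ^ ((m + 1) * n - 1) := by
  have h1 : |((hermitePoly m n k).map (Int.castRingHom ℝ)).eval x| ≤
      (max (m : ℝ) x) ^ ((m + 1) * n - 1) := by
    rw [eval_map_hermitePoly, Finset.abs_prod, ← sum_exponents hn hk,
      ← Finset.prod_pow_eq_pow_sum]
    refine Finset.prod_le_prod (fun i _ => abs_nonneg _) fun i hi => ?_
    rw [abs_pow]
    have hi' : (i : ℝ) ≤ m := by
      exact_mod_cast Nat.lt_succ_iff.mp (Finset.mem_range.mp hi)
    refine pow_le_pow_left₀ (abs_nonneg _) (abs_le.mpr ⟨?_, ?_⟩) _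
    · linarith [le_max_left (m : ℝ) x]
    · linarith [le_max_right (m : ℝ) x, (Nat.cast_nonneg i : (0 : ℝ) ≤ i)]
  refine h1.trans ?_
  rcases max_cases (m : ℝ) x with ⟨h, _⟩ | ⟨h, _⟩ <;> rw [h]
  · linarith [pow_nonneg hx ((m + 1) * n - 1)]
  · linarith [pow_nonneg (Nat.cast_nonneg m : (0 : ℝ) ≤ m) ((m + 1) * n - 1)]

/-- A nonzero integer of an imaginary quadratic field has absolute value at least `1`, its norm
being the square of its absolute value. -/
theorem one_le_norm_of_ne_zero {K : Type*} [Field K] [NumberField K]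
    [NumberField.IsTotallyComplex K] (hK : Module.finrank ℚ K = 2) (ψ : K →+* ℂ)
    {a : NumberField.RingOfIntegers K} (ha : a ≠ 0) : 1 ≤ ‖ψ a‖ := by
  have hcard : Fintype.card (NumberField.InfinitePlace K) = 1 := by
    have h1 := NumberField.IsTotallyComplex.finrank K
    have h2 := NumberField.InfinitePlace.card_eq_nrRealPlaces_add_nrComplexPlaces K
    have h3 := NumberField.IsTotallyComplex.nrRealPlaces_eq_zero K
    omega
  have := Fintype.card_le_one_iff_subsingleton.mp hcard.le
  have h := NumberField.InfinitePlace.one_le_of_lt_one (w := NumberField.InfinitePlace.mk ψ) ha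
    fun z hz => absurd (Subsingleton.elim z _) hz
  rwa [NumberField.InfinitePlace.apply] at h

/-! ### The lower bound in terms of the common factor -/

theorem eval_intCast_map_hermitePoly {R : Type*} [CommRing R] (m n k j : ℕ) :
    (sumIDeriv ((hermitePoly m n k).map (Int.castRingHom R))).eval (j : R) =
      (((sumIDeriv (hermitePoly m n k)).eval (j : ℤ) : ℤ) : R) := by
  rw [sumIDeriv_map, ← Int.cast_natCast (R := R) j, eval_intCast_map]
  rfl

/-- Siegel's argument: one of the approximations gives a nonzero integer
`W = ∑ λ_j F(j) / G` of the field, with `G = commonFactor m n`, so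
`G ≤ |F(0)| |Λ| + ∑ |λ_j| |e^j F(0) - F(j)|`, where the last sum is at most `G / 2`. -/
theorem commonFactor_le_mul_norm {K : Type*} [Field K] [NumberField K]
    [NumberField.IsTotallyComplex K] (hK : Module.finrank ℚ K = 2) (ψ : K →+* ℂ)
    {m n : ℕ} (hn : 1 ≤ n) {H : ℝ} (hH0 : 0 < H)
    {lam : Fin (m + 1) → NumberField.RingOfIntegers K} (hlam : lam ≠ 0)
    (hlamH : ∀ j : Fin (m + 1), j ≠ 0 → ‖ψ (lam j)‖ ≤ H) {M A : ℝ}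
    (hM : ∀ x : ℝ, 0 ≤ x → x ≤ m → |∏ i ∈ Finset.range (m + 1), (x - i)| ≤ M)
    (hA : ∀ k ≤ m, ∀ x : ℝ, 0 ≤ x → x ≤ m →
      |∏ i ∈ (Finset.range (m + 1)).erase k, (x - i)| ≤ A)
    (hR : 2 * H * ((∑ j ∈ Finset.range (m + 1), (Real.exp j - 1)) * (A * M ^ (n - 1))) ≤
      commonFactor m n) :
    (commonFactor m n : ℝ) ≤ 2 * ((m : ℝ) ^ ((m + 1) * n - 1) + ((m + 1) * n - 1)!) *
      ‖∑ j : Fin (m + 1), ψ (lam j) * Complex.exp 1 ^ (j : ℕ)‖ := by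
  set G : ℝ := (commonFactor m n : ℝ) with hG
  have hGpos : 0 < G := by rw [hG]; exact_mod_cast commonFactor_pos m n
  set a : ℕ → ℂ := fun j => if h : j < m + 1 then ψ (lam ⟨j, h⟩) else 0 with ha
  have haj : ∀ j : Fin (m + 1), a j = ψ (lam j) := fun j => dif_pos j.isLt
  obtain ⟨k, hk, hne⟩ : ∃ k ≤ m, ∑ j ∈ Finset.range (m + 1), a j *
      (sumIDeriv ((hermitePoly m n k).map (Int.castRingHom ℂ))).eval (j : ℂ) ≠ 0 := by
    by_contra! hcon
    have h0 := eq_zero_of_forall_sumIDeriv hn hcon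
    apply hlam
    funext j
    have h1 := h0 j (Nat.lt_succ_iff.mp j.isLt)
    rw [haj, map_eq_zero] at h1
    exact_mod_cast h1
  set I : ℕ → ℤ := fun j => (sumIDeriv (hermitePoly m n k)).eval (j : ℤ) with hI
  have hq : ∀ j : Fin (m + 1), ∃ q : ℤ, I j = commonFactor m n * q := fun j =>
    commonFactor_dvd k hn (Nat.lt_succ_iff.mp j.isLt)
  choose q hq using hq
  set W : NumberField.RingOfIntegers K := ∑ j, lam j * (q j : NumberField.RingOfIntegers K) with hW
  have hGW : (G : ℂ) * ψ W = ∑ j : Fin (m + 1), ψ (lam j) * (I j : ℂ) := by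
    have h1 : ψ W = ∑ j : Fin (m + 1), ψ (lam j) * (q j : ℂ) := by
      rw [hW]; push_cast [map_sum]
      simp
    rw [h1, Finset.mul_sum]
    refine Finset.sum_congr rfl fun j _ => ?_
    rw [hq j, hG]
    push_cast
    ring
  have hWne : W ≠ 0 := by
    intro h0
    apply hne
    rw [h0] at hGW
    simp only [eval_intCast_map_hermitePoly]
    rw [Finset.sum_range fun j => a j * ((I j : ℤ) : ℂ)]
    simp only [haj]
    rw [← hGW]
    simp
  have hW1 : G ≤ ‖∑ j : Fin (m + 1), ψ (lam j) * (I j : ℂ)‖ := by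
    rw [← hGW, norm_mul, Complex.norm_real, Real.norm_of_nonneg hGpos.le]
    exact le_mul_of_one_le_right hGpos.le (one_le_norm_of_ne_zero hK ψ hWne)
  -- the bounds for `F(0)` and for the remainders `e^j F(0) - F(j)`
  set f := (hermitePoly m n k).map (Int.castRingHom ℝ) with hf
  have hfI : ∀ j : ℕ, (sumIDeriv f).eval (j : ℝ) = (I j : ℝ) := fun j =>
    eval_intCast_map_hermitePoly m n k j
  have hI0 : |(I 0 : ℝ)| ≤ (m : ℝ) ^ ((m + 1) * n - 1) + ((m + 1) * n - 1)! := by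
    rw [← hfI, Nat.cast_zero]
    exact abs_eval_zero_sumIDeriv_le fun x hx => abs_eval_map_hermitePoly_le hn hk hx
  have hM0 : 0 ≤ M := (abs_nonneg _).trans (hM 0 le_rfl (Nat.cast_nonneg m))
  have hrem : ∀ j ∈ Finset.range (m + 1), |Real.exp j * I 0 - I j| ≤
      (Real.exp j - 1) * (A * M ^ (n - 1)) := by
    intro j hj
    have hjm : (j : ℝ) ≤ m := by exact_mod_cast Nat.lt_succ_iff.mp (Finset.mem_range.mp hj)
    rw [← hfI, ← hfI, Nat.cast_zero]
    refine abs_exp_mul_sumIDeriv_sub_le (Nat.cast_nonneg j) fun x hx hxj => ?_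
    rw [hf, eval_map_hermitePoly_eq_mul hn hk, abs_mul, abs_pow, mul_comm]
    exact mul_le_mul (hA k hk x hx (hxj.trans hjm))
      (pow_le_pow_left₀ (abs_nonneg _) (hM x hx (hxj.trans hjm)) _)
      (pow_nonneg (abs_nonneg _) _) ((abs_nonneg _).trans (hA k hk x hx (hxj.trans hjm)))
  set Lam := ∑ j : Fin (m + 1), ψ (lam j) * Complex.exp 1 ^ (j : ℕ) with hLam
  have hexp : ∀ j : ℕ, Complex.exp 1 ^ j = ((Real.exp j : ℝ) : ℂ) := fun j => by
    rw [← Complex.exp_nat_mul, mul_one, Complex.ofReal_exp, Complex.ofReal_natCast]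
  have hid : ∑ j : Fin (m + 1), ψ (lam j) * (I j : ℂ) = (I 0 : ℂ) * Lam -
      ∑ j : Fin (m + 1), ψ (lam j) * ((Real.exp (j : ℕ) * I 0 - I j : ℝ) : ℂ) := by
    rw [hLam, Finset.mul_sum, ← Finset.sum_sub_distrib]
    refine Finset.sum_congr rfl fun j _ => ?_
    rw [hexp]
    push_cast
    ring
  have hsum : ‖∑ j : Fin (m + 1), ψ (lam j) * ((Real.exp (j : ℕ) * I 0 - I j : ℝ) : ℂ)‖ ≤
      H * ((∑ j ∈ Finset.range (m + 1), (Real.exp j - 1)) * (A * M ^ (n - 1))) := by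
    rw [Finset.sum_range fun j : ℕ => Real.exp j - 1, Finset.sum_mul, Finset.mul_sum]
    refine (norm_sum_le _ _).trans (Finset.sum_le_sum fun j _ => ?_)
    rw [norm_mul, Complex.norm_real, Real.norm_eq_abs]
    have hr := hrem j (Finset.mem_range.mpr j.isLt)
    by_cases hj : j = 0
    · subst hj
      simp
    · exact mul_le_mul (hlamH j hj) hr (abs_nonneg _) hH0.le
  have hfin : G ≤ |(I 0 : ℝ)| * ‖Lam‖ + G / 2 := by
    refine hW1.trans ?_
    rw [hid]
    refine (norm_sub_le _ _).trans (add_le_add ?_ ?_)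
    · rw [norm_mul, Complex.norm_intCast]
    · linarith
  have h2 := mul_le_mul_of_nonneg_right hI0 (norm_nonneg Lam)
  linarith

/-! ### Sizes of factorials and of the common factor -/

theorem mul_log_le_log_one_add {p a : ℕ} (ha : a < p) :
    (a : ℝ) * Real.log p ≤ ((p : ℝ) - 1) * Real.log (1 + a) := by
  rcases Nat.eq_zero_or_pos a with rfl | ha0
  · simp
  have ha1 : (0 : ℝ) < a := by exact_mod_cast ha0
  have hap : (a : ℝ) ≤ p - 1 := by
    have : (a : ℝ) + 1 ≤ p := by exact_mod_cast ha
    linarith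
  have hr : (1 : ℝ) ≤ (p - 1) / a := (one_le_div ha1).mpr hap
  have hb := one_add_mul_self_le_rpow_one_add (s := (a : ℝ)) (by linarith) hr
  have h1 : 1 + ((p : ℝ) - 1) / a * a = p := by field_simp; ring
  rw [h1] at hb
  have hp : (0 : ℝ) < p := by linarith
  have h2 := Real.log_le_log hp hb
  rw [Real.log_rpow (by linarith)] at h2
  calc (a : ℝ) * Real.log p ≤ a * (((p : ℝ) - 1) / a * Real.log (1 + a)) :=
        mul_le_mul_of_nonneg_left h2 ha1.le
    _ = _ := by field_simp

/-- The digit sum `σ` of `n` in base `p` satisfies `p^{σ/(p-1)} ≤ n + 1`. -/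
theorem digits_sum_mul_log_le {p : ℕ} (hp : 1 < p) (n : ℕ) :
    ((p.digits n).sum : ℝ) * Real.log p ≤ ((p : ℝ) - 1) * Real.log (n + 1) := by
  have hp1 : (1 : ℝ) < p := by exact_mod_cast hp
  induction n using Nat.strong_induction_on with
  | _ n ih =>
    rcases Nat.eq_zero_or_pos n with rfl | hn
    · simp
    rw [Nat.digits_def' hp hn, List.sum_cons, Nat.cast_add, add_mul]
    have h1 := mul_log_le_log_one_add (Nat.mod_lt n (by omega : p > 0))
    have h2 := ih (n / p) (Nat.div_lt_self hn hp)
    refine (add_le_add h1 h2).trans ?_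
    rw [← mul_add, ← Real.log_mul (by positivity) (by positivity)]
    refine mul_le_mul_of_nonneg_left (Real.log_le_log (by positivity) ?_) (by linarith)
    have h3 : (n : ℝ) = p * (n / p : ℕ) + (n % p : ℕ) := by exact_mod_cast (Nat.div_add_mod n p).symm
    have h4 : ((n % p : ℕ) : ℝ) + 1 ≤ p := by exact_mod_cast Nat.mod_lt n (by omega : p > 0)
    have h5 : (0 : ℝ) ≤ (n / p : ℕ) := Nat.cast_nonneg _
    nlinarith

theorem padicValNat_factorial_mul_log_ge {p : ℕ} (hp : p.Prime) (n : ℕ) :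
    n * (Real.log p / (p - 1)) - Real.log (n + 1) ≤ padicValNat p (n !) * Real.log p := by
  have := Fact.mk hp
  have hp1 : (0 : ℝ) < (p : ℝ) - 1 := by
    have : (1 : ℝ) < p := by exact_mod_cast hp.one_lt
    linarith
  have h1 : ((p : ℝ) - 1) * padicValNat p (n !) = n - (p.digits n).sum := by
    have h := sub_one_mul_padicValNat_factorial (p := p) n
    have h2 : ((p - 1 : ℕ) : ℝ) * padicValNat p (n !) = ((n - (p.digits n).sum : ℕ) : ℝ) := by
      exact_mod_cast h
    rwa [Nat.cast_sub hp.one_le, Nat.cast_sub (Nat.digit_sum_le p n), Nat.cast_one] at h2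
  have h2 := digits_sum_mul_log_le hp.one_lt n
  refine le_of_mul_le_mul_left ?_ hp1
  have h3 : ((p : ℝ) - 1) * (n * (Real.log p / (p - 1)) - Real.log (n + 1)) =
      n * Real.log p - (p - 1) * Real.log (n + 1) := by field_simp
  rw [h3, ← mul_assoc, h1]
  linarith

/-- The sum of `minFloor m p` over the primes `p ≤ (m + 1)/2`. -/
def floorSum (m : ℕ) : ℕ :=
  ∑ p ∈ (Finset.Icc 1 ((m + 1) / 2)).filter Nat.Prime, minFloor m p

/-- The sum `∑ minFloor m p · log p / (p - 1)` over the primes `p ≤ (m + 1)/2`, which is `m κ_m`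
without the weights `w_p`. -/
noncomputable def kappaSum (m : ℕ) : ℝ :=
  ∑ p ∈ (Finset.Icc 1 ((m + 1) / 2)).filter Nat.Prime,
    (minFloor m p : ℝ) * (Real.log p / (p - 1))

theorem log_commonFactor_ge (m n : ℕ) :
    Real.log ((n - 1)!) + n * kappaSum m - floorSum m * Real.log (n + 1) ≤
      Real.log (commonFactor m n) := by
  have hfac : ∀ q ∈ (Finset.Icc 1 ((m + 1) / 2)).filter Nat.Prime,
      (q : ℝ) ^ (minFloor m q * padicValNat q (n !)) ≠ 0 := fun q hq =>
    pow_ne_zero _ (Nat.cast_ne_zero.mpr (Finset.mem_filter.mp hq).2.ne_zero)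
  rw [commonFactor, Nat.cast_mul, Nat.cast_prod]
  simp only [Nat.cast_pow]
  rw [Real.log_mul (Nat.cast_ne_zero.mpr (Nat.factorial_ne_zero _))
    (Finset.prod_ne_zero_iff.mpr hfac), Real.log_prod hfac, add_sub_assoc]
  refine add_le_add_right ?_ _
  rw [kappaSum, floorSum, Nat.cast_sum, Finset.mul_sum, Finset.sum_mul, ← Finset.sum_sub_distrib]
  refine Finset.sum_le_sum fun p hp => ?_
  have h := mul_le_mul_of_nonneg_left
    (padicValNat_factorial_mul_log_ge (Finset.mem_filter.mp hp).2 n)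
    (Nat.cast_nonneg (minFloor m p) : (0 : ℝ) ≤ minFloor m p)
  rw [Real.log_pow, Nat.cast_mul]
  linarith

theorem log_factorial_le {n : ℕ} (hn : 1 ≤ n) :
    Real.log (n !) ≤ 1 + 1 / 2 * Real.log n + n * Real.log n - n := by
  have h1 : Stirling.stirlingSeq n ≤ Stirling.stirlingSeq 1 := by
    have := Stirling.stirlingSeq'_antitone (Nat.zero_le (n - 1))
    simp only [Function.comp_apply, Nat.succ_eq_add_one, Nat.sub_add_cancel hn, zero_add] at this
    exact this
  have hpos : 0 < Stirling.stirlingSeq n := by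
    have := Stirling.stirlingSeq'_pos (n - 1)
    rwa [Nat.sub_add_cancel hn] at this
  have h2 := Real.log_le_log hpos h1
  have hn0 : (n : ℝ) ≠ 0 := Nat.cast_ne_zero.mpr (by omega)
  rw [Stirling.log_stirlingSeq_formula, Stirling.log_stirlingSeq_formula,
    Real.log_mul two_ne_zero hn0, Real.log_div hn0 (Real.exp_ne_zero 1), Real.log_exp] at h2
  simp only [Nat.factorial_one, Nat.cast_one, Real.log_one, mul_one, one_div, Real.log_inv,
    Real.log_exp] at h2
  linarith

theorem log_two_pi_ge : 1.79 ≤ Real.log (2 * Real.pi) := by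
  have h1 : Real.log (2 * 3) ≤ Real.log (2 * Real.pi) :=
    Real.log_le_log (by norm_num) (by linarith [Real.pi_gt_three])
  rw [Real.log_mul two_ne_zero three_ne_zero] at h1
  linarith [Real.log_two_gt_d9, Real.log_three_gt_d9]

theorem log_factorial_pred {n : ℕ} (hn : 1 ≤ n) :
    Real.log ((n - 1)!) = Real.log (n !) - Real.log n := by
  have hn0 : (n : ℝ) ≠ 0 := Nat.cast_ne_zero.mpr (by omega)
  have h : (n !  : ℝ) = n * (n - 1)! := by
    exact_mod_cast (Nat.mul_factorial_pred (by omega)).symm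
  rw [h, Real.log_mul hn0 (Nat.cast_ne_zero.mpr (Nat.factorial_ne_zero _))]
  ring

theorem log_factorial_pred_ge {n : ℕ} (hn : 1 ≤ n) :
    n * Real.log n - n - 1 / 2 * Real.log n + 0.895 ≤ Real.log ((n - 1)!) := by
  rw [log_factorial_pred hn]
  linarith [Stirling.le_log_factorial_stirling (n := n) (by omega), log_two_pi_ge]

theorem log_factorial_sub_le {m n : ℕ} (hn : 1 ≤ n) :
    Real.log (((m + 1) * n - 1)!) - Real.log ((n - 1)!) ≤
      m * n * Real.log n + ((m + 1) * Real.log (m + 1) - m) * n + 0.105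
        - 1 / 2 * Real.log (m + 1) := by
  have hN : 1 ≤ (m + 1) * n := Nat.mul_pos (Nat.succ_pos m) hn
  have hn0 : (n : ℝ) ≠ 0 := Nat.cast_ne_zero.mpr (by omega)
  have hm0 : (m : ℝ) + 1 ≠ 0 := by positivity
  have h1 := log_factorial_le hN
  have h2 := Stirling.le_log_factorial_stirling (n := n) (by omega)
  rw [log_factorial_pred hn, log_factorial_pred hN]
  push_cast at h1 ⊢
  rw [Real.log_mul hm0 hn0] at h1 ⊢
  linarith [log_two_pi_ge]

theorem pow_le_factorial {m n : ℕ} (hm : 1 ≤ m) (hn : 3 ≤ n) :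
    (m : ℝ) ^ ((m + 1) * n - 1) ≤ (((m + 1) * n - 1)! : ℝ) := by
  set N := (m + 1) * n - 1 with hN
  have h3 : 3 * m + 1 ≤ N := by
    have : (m + 1) * 3 ≤ (m + 1) * n := Nat.mul_le_mul_left _ hn
    omega
  have hm0 : (0 : ℝ) < m := by exact_mod_cast hm
  have hNR : 3 * (m : ℝ) + 1 ≤ N := by exact_mod_cast h3
  have hlog : 1 + Real.log m ≤ Real.log N := by
    have h4 : Real.log (Real.exp 1 * m) ≤ Real.log N := by
      refine Real.log_le_log (by positivity) ?_
      nlinarith [Real.exp_one_lt_three]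
    rwa [Real.log_mul (Real.exp_ne_zero 1) hm0.ne', Real.log_exp] at h4
  have h5 := Stirling.le_log_factorial_stirling (n := N) (by omega)
  have h6 : 0 ≤ Real.log N := Real.log_natCast_nonneg N
  have hN0 : (0 : ℝ) ≤ N := Nat.cast_nonneg N
  rw [← Real.log_le_log_iff (by positivity) (by positivity), Real.log_pow]
  have h7 := mul_le_mul_of_nonneg_left hlog hN0
  linarith [log_two_pi_ge]

/-! ### The lower bound in terms of numerical parameters -/

theorem exists_nat_le_mul_log (c L : ℝ) : ∃ n : ℕ, L ≤ n * Real.log n - c * n := by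
  obtain ⟨n, hn⟩ := exists_nat_ge (max (Real.exp (c + 1)) |L|)
  refine ⟨n, ?_⟩
  have h1 : Real.exp (c + 1) ≤ n := (le_max_left _ _).trans hn
  have h2 : |L| ≤ n := (le_max_right _ _).trans hn
  have hn0 : (0 : ℝ) < n := (Real.exp_pos _).trans_le h1
  have h3 : c + 1 ≤ Real.log n := (Real.le_log_iff_exp_le hn0).mpr h1
  nlinarith [le_abs_self L]

/-- Comparison of the size `m n log n + b₀ n + σ` of the denominator, where `n = x + 1`, with the
bound in terms of `z ≥ r x`, using `x log x - d' x < L`. -/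
theorem size_lt_of_parameters {m x L z B d D d' r s b₀ σ : ℝ} (hm : 0 < m) (hx : 0 < x)
    (hB : 0 ≤ B) (hr : 0 < r) (hxL : x * Real.log x - d' * x < L) (hexp : Real.exp s ≤ x)
    (hrz : r * x ≤ z) (hD : m + (B - m * d) + m * Real.exp (-s) ≤ D)
    (hden : (m * d' + b₀ - B * r) * x + (b₀ - (B - m * d)) + σ ≤ m * Real.log r) :
    m * (x + 1) * Real.log (x + 1) + b₀ * (x + 1) + σ < D + m * L + (B * z + m * Real.log z) := by
  have h3 : Real.log (x + 1) ≤ Real.log x + 1 / x := by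
    have h4 : x + 1 = x * (1 + 1 / x) := by field_simp
    rw [h4, Real.log_mul hx.ne' (by positivity)]
    linarith [Real.log_le_sub_one_of_pos (show (0 : ℝ) < 1 + 1 / x by positivity)]
  have h5 : m * (x + 1) * Real.log (x + 1) ≤
      m * (x * Real.log x) + m * Real.log x + m + m * (1 / x) := by
    calc m * (x + 1) * Real.log (x + 1) ≤ m * (x + 1) * (Real.log x + 1 / x) :=
          mul_le_mul_of_nonneg_left h3 (by positivity)
      _ = _ := by field_simp; ring
  have h8 : 1 / x ≤ Real.exp (-s) := by
    rw [Real.exp_neg, one_div]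
    exact inv_anti₀ (Real.exp_pos _) hexp
  have h9 := mul_lt_mul_of_pos_left hxL hm
  have h10 := mul_le_mul_of_nonneg_left h8 hm.le
  have h11 := mul_le_mul_of_nonneg_left hrz hB
  have h12 : Real.log r + Real.log x ≤ Real.log z := by
    rw [← Real.log_mul hr.ne' hx.ne']
    exact Real.log_le_log (by positivity) hrz
  have h13 := mul_le_mul_of_nonneg_left h12 hm.le
  linarith

/-- The lower bound for the linear form from numerical conditions on the parameters. Here `M` and
`A` bound `|Π|` and `|Π / (X - k)|` on `[0, m]`, `Π = X (X - 1) ⋯ (X - m)`, the order `n` of the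
approximations is the least one with `n log n - d' n ≥ log (2H)`, and `r` is such that
`z(log (2H) / (1 - d/s)) ≥ r (n - 1)`. The hypothesis `hrem` makes the remainders of order `n`
small enough, and `hden` compares the denominator with the claimed bound. -/
theorem lower_bound_of_parameters {K : Type*} [Field K] [NumberField K]
    [NumberField.IsTotallyComplex K] (hK : Module.finrank ℚ K = 2) (ψ : K →+* ℂ)
    {m : ℕ} (hm : 1 ≤ m) {H : ℝ} (hH0 : 0 < H)
    (hH : s m * Real.exp (s m) ≤ Real.log H)
    {lam : Fin (m + 1) → NumberField.RingOfIntegers K} (hlam : lam ≠ 0)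
    (hlamH : ∀ j : Fin (m + 1), j ≠ 0 → ‖ψ (lam j)‖ ≤ H) {M A E d' r : ℝ}
    (hM0 : 0 < M) (hA0 : 0 < A) (hE0 : 0 < E) (hr0 : 0 < r)
    (hM : ∀ x : ℝ, 0 ≤ x → x ≤ m → |∏ i ∈ Finset.range (m + 1), (x - i)| ≤ M)
    (hA : ∀ k ≤ m, ∀ x : ℝ, 0 ≤ x → x ≤ m →
      |∏ i ∈ (Finset.range (m + 1)).erase k, (x - i)| ≤ A)
    (hE : ∑ j ∈ Finset.range (m + 1), (Real.exp j - 1) ≤ E)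
    (hs0 : 0 ≤ s m) (hds : d m < s m) (hB : 0 ≤ B m)
    (hD : m + (B m - m * d m) + m * Real.exp (-s m) ≤ D m) {n₀ : ℕ} (hn₀ : 3 ≤ n₀)
    (hlarge : ∀ n : ℕ, s m * Real.exp (s m) + Real.log 2 ≤ n * Real.log n - d' * n →
      n₀ ≤ n ∧ Real.exp (s m) ≤ n - 1)
    (hrem : ∀ n : ℕ, n₀ ≤ n → Real.exp (s m) ≤ n - 1 →
      Real.log E + Real.log A - Real.log M + 1 / 2 * Real.log n - 0.895
        + floorSum m * Real.log (n + 1) ≤ (d' - 1 - Real.log M + kappaSum m) * n)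
    (hz : ∀ n : ℕ, n₀ ≤ n → Real.exp (s m) ≤ n - 1 →
      r * (Real.log (n - 1) + Real.log r) * (1 - d m / s m) ≤ Real.log (n - 1) - d')
    (hden : ∀ n : ℕ, n₀ ≤ n → Real.exp (s m) ≤ n - 1 →
      (m * d' + ((m + 1) * Real.log (m + 1) - m - kappaSum m) - B m * r) * (n - 1)
        + (((m + 1) * Real.log (m + 1) - m - kappaSum m) - (B m - m * d m))
        + (Real.log 2 + 0.105 - 1 / 2 * Real.log (m + 1) + floorSum m * Real.log (n + 1))
        ≤ m * Real.log r) :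
    1 / (2 * Real.exp (D m)) * (2 * H) ^ (-(m : ℝ) - eps m H)
      < ‖∑ j : Fin (m + 1), ψ (lam j) * Complex.exp 1 ^ (j : ℕ)‖ := by
  set L := Real.log (2 * H) with hL
  have hLH : L = Real.log 2 + Real.log H := Real.log_mul two_ne_zero hH0.ne'
  have hL0 : 0 < L := by
    have h1 : 0 ≤ s m * Real.exp (s m) := mul_nonneg hs0 (Real.exp_pos _).le
    have h2 := Real.log_pos one_lt_two
    linarith
  classical
  have hex := exists_nat_le_mul_log d' L
  obtain ⟨n, hnL, hmin⟩ : ∃ n : ℕ, L ≤ n * Real.log n - d' * n ∧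
      ∀ k < n, (k : ℝ) * Real.log k - d' * k < L :=
    ⟨Nat.find hex, Nat.find_spec hex, fun k hk => not_le.mp (Nat.find_min hex hk)⟩
  obtain ⟨hn, hexp⟩ := hlarge n (by linarith)
  have hrem' := hrem n hn hexp
  have hz' := hz n hn hexp
  have hden' := hden n hn hexp
  have hx := hmin (n - 1) (by omega)
  rw [Nat.cast_sub (by omega : 1 ≤ n), Nat.cast_one] at hx
  set x : ℝ := (n : ℝ) - 1 with hxdef
  have hnx : (n : ℝ) = x + 1 := by rw [hxdef]; ring
  have hx2 : 2 ≤ x := by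
    have : (3 : ℝ) ≤ n := by exact_mod_cast hn₀.trans hn
    linarith
  have hx0 : 0 < x := by linarith
  -- the remainders are small
  have hR : 2 * H * ((∑ j ∈ Finset.range (m + 1), (Real.exp j - 1)) * (A * M ^ (n - 1))) ≤
      commonFactor m n := by
    have hG : (0 : ℝ) < commonFactor m n := by exact_mod_cast commonFactor_pos m n
    have h1 : 2 * H * (E * (A * M ^ (n - 1))) ≤ commonFactor m n := by
      have h0 : Real.log (2 * H * (E * (A * M ^ (n - 1)))) =
          L + (Real.log E + (Real.log A + ((n : ℝ) - 1) * Real.log M)) := by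
        rw [Real.log_mul (by positivity) (by positivity),
          Real.log_mul hE0.ne' (by positivity), Real.log_mul hA0.ne' (by positivity),
          Real.log_pow, Nat.cast_sub (by omega : 1 ≤ n), Nat.cast_one]
      rw [← Real.log_le_log_iff (by positivity) hG, h0]
      refine le_trans ?_ (log_commonFactor_ge m n)
      have h2 := log_factorial_pred_ge (n := n) (by omega)
      linarith
    refine le_trans ?_ h1
    gcongr
  have hmain := commonFactor_le_mul_norm hK ψ (by omega : 1 ≤ n) hH0 hlam hlamH hM hA hR
  set Lam := ∑ j : Fin (m + 1), ψ (lam j) * Complex.exp 1 ^ (j : ℕ) with hLam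
  have hpow := pow_le_factorial hm (hn₀.trans hn)
  set N := (m + 1) * n - 1 with hN
  have hG : (0 : ℝ) < commonFactor m n := by exact_mod_cast commonFactor_pos m n
  have hNf : (0 : ℝ) < N ! := by exact_mod_cast Nat.factorial_pos N
  have hmain2 : (commonFactor m n : ℝ) ≤ 4 * N ! * ‖Lam‖ :=
    hmain.trans (mul_le_mul_of_nonneg_right (by linarith) (norm_nonneg _))
  -- the value of `z`
  have hds1 : 0 < 1 - d m / s m := by
    rcases hs0.eq_or_lt with h | h
    · rw [← h, div_zero]; norm_num
    · rw [sub_pos, div_lt_one h]; exact hds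
  set z := zInv (L / (1 - d m / s m)) with hzdef
  obtain ⟨hz1, hz2⟩ := zInv_spec (y := L / (1 - d m / s m))
    ((neg_nonpos.mpr (Real.exp_pos _).le).trans (div_pos hL0 hds1).le)
  rw [← hzdef] at hz1 hz2
  have hz0 : 0 < z := (Real.exp_pos _).trans_le hz1
  have hrz : r * x ≤ z := by
    by_contra! hlt
    have h1 : z * Real.log z < r * x * Real.log (r * x) :=
      Real.mul_log_strictMonoOn hz1 (hz1.trans hlt.le) hlt
    have h2 : z * Real.log z * (1 - d m / s m) = L := by
      rw [hz2, div_mul_cancel₀ _ hds1.ne']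
    have h3 := mul_lt_mul_of_pos_right h1 hds1
    rw [h2, Real.log_mul hr0.ne' hx0.ne'] at h3
    have h4 := mul_le_mul_of_nonneg_left hz' hx0.le
    linarith
  -- the denominator is small
  have hsize : Real.log (N !) - Real.log (commonFactor m n) + Real.log 2 <
      D m + m * L + (B m * z + m * Real.log z) := by
    have h1 := log_commonFactor_ge m n
    have h2 := log_factorial_sub_le (m := m) (n := n) (by omega)
    have h3 := size_lt_of_parameters (by exact_mod_cast hm : (0 : ℝ) < m) hx0 hB hr0 hx hexp hrz hD
      hden'
    rw [hnx] at h1 h2 h3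
    linarith
  have hLampos : 0 < ‖Lam‖ := by
    by_contra! h
    have h0 : ‖Lam‖ = 0 := le_antisymm h (norm_nonneg _)
    rw [h0, mul_zero] at hmain2
    linarith
  rw [← Real.log_lt_log_iff (by positivity) hLampos, Real.log_mul (by positivity) (by positivity),
    Real.log_rpow (by positivity), one_div, Real.log_inv, Real.log_mul two_ne_zero
    (Real.exp_ne_zero _), Real.log_exp, ← hL]
  have heps : eps m H * L = B m * z + m * Real.log z := by
    rw [eps, ← hL, ← hzdef]
    exact div_mul_cancel₀ _ hL0.ne'
  have hlog := Real.log_le_log hG hmain2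
  rw [Real.log_mul (by positivity) hLampos.ne', Real.log_mul (by norm_num) hNf.ne',
    Real.log_four_eq] at hlog
  linarith

/-! ### Numerical tools and the maximum of `|x (x - 1) ⋯ (x - m)|` -/

theorem le_exp_div {a : ℝ} {j k : ℕ} (hk : k ≠ 0) (h : a ^ k ≤ 2.7182818283 ^ j) :
    a ≤ Real.exp (j / k) := by
  refine le_of_pow_le_pow_left₀ hk (Real.exp_pos _).le (h.trans ?_)
  have hk0 : (k : ℝ) ≠ 0 := Nat.cast_ne_zero.mpr hk
  rw [← Real.exp_nat_mul, mul_div_cancel₀ _ hk0, ← mul_one (j : ℝ), Real.exp_nat_mul]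
  exact pow_le_pow_left₀ (by norm_num) Real.exp_one_gt_d9.le _

theorem exp_div_le {a : ℝ} (ha : 0 ≤ a) {j k : ℕ} (hk : k ≠ 0) (h : 2.7182818286 ^ j ≤ a ^ k) :
    Real.exp (j / k) ≤ a := by
  refine le_of_pow_le_pow_left₀ hk ha (le_trans ?_ h)
  have hk0 : (k : ℝ) ≠ 0 := Nat.cast_ne_zero.mpr hk
  rw [← Real.exp_nat_mul, mul_div_cancel₀ _ hk0, ← mul_one (j : ℝ), Real.exp_nat_mul]
  exact pow_le_pow_left₀ (Real.exp_pos _).le Real.exp_one_lt_d9.le _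

/-- The logarithm lies below its tangent line at `c`, where `log c ≤ q`. -/
theorem log_le_tangent {c q t : ℝ} (hc : 0 < c) (hq : c ≤ Real.exp q) (ht : 0 < t) :
    Real.log t ≤ q + t / c - 1 := by
  have h1 : Real.log c ≤ q := (Real.log_le_iff_le_exp hc).mpr hq
  have h2 := Real.log_le_sub_one_of_pos (div_pos ht hc)
  rw [Real.log_div ht.ne' hc.ne'] at h2
  linarith

/-- A positive value of `n (log n - c)` increases with `n`, so it is less than `T` for `n < n₀`. -/
theorem le_of_le_mul_log_sub {n n₀ : ℕ} {q c T : ℝ} (hT : T ≤ n * Real.log n - c * n) (hT0 : 0 < T)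
    (hq : (n₀ : ℝ) ≤ Real.exp q) (h : n₀ * (q - c) < T) : n₀ ≤ n := by
  by_contra! hlt
  have hnR : (n : ℝ) ≤ n₀ := by exact_mod_cast hlt.le
  have hn0 : 0 < n := by
    rcases Nat.eq_zero_or_pos n with rfl | h0
    · simp at hT; linarith
    · exact h0
  have hn : (0 : ℝ) < n := by exact_mod_cast hn0
  have h1 : Real.log n ≤ q := (Real.log_le_iff_le_exp hn).mpr (hnR.trans hq)
  have h2 : 0 < n * (Real.log n - c) := by linarith
  have h3 : 0 < Real.log n - c := pos_of_mul_pos_right h2 hn.le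
  have h4 : n * (Real.log n - c) ≤ n₀ * (q - c) :=
    mul_le_mul hnR (by linarith) h3.le (Nat.cast_nonneg _)
  linarith

/-- For `n < exp u + 1` the expression `n log n - c n` does not reach `u exp u + log 2`, because the
hypothesis on `c` makes it at most `u exp u` at `n = exp u + 1`. -/
theorem exp_le_sub_one_of_le_mul_log_sub {n : ℕ} {u c : ℝ} (hu : 0 < u)
    (hT : u * Real.exp u + Real.log 2 ≤ n * Real.log n - c * n)
    (h : u + 1 + Real.exp (-u) ≤ c * (Real.exp u + 1)) : Real.exp u ≤ n - 1 := by
  by_contra! hlt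
  have hl2 := Real.log_pos one_lt_two
  have he := Real.exp_pos u
  have hT0 : 0 < u * Real.exp u + Real.log 2 := by positivity
  have hn0 : 0 < n := by
    rcases Nat.eq_zero_or_pos n with rfl | h0
    · simp at hT; linarith
    · exact h0
  have hn : (0 : ℝ) < n := by exact_mod_cast hn0
  have hlog : Real.log n ≤ u + Real.exp (-u) := by
    have h1 : Real.log n ≤ Real.log (Real.exp u * (1 + Real.exp (-u))) := by
      refine Real.log_le_log hn ?_
      rw [mul_add, ← Real.exp_add]
      simp; linarith
    rw [Real.log_mul he.ne' (by positivity), Real.log_exp] at h1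
    have h2 := Real.log_le_sub_one_of_pos (show 0 < 1 + Real.exp (-u) by positivity)
    linarith
  have h2 : 0 < n * (Real.log n - c) := by linarith
  have h3 : 0 < Real.log n - c := pos_of_mul_pos_right h2 hn.le
  have h4 : n * (Real.log n - c) ≤ (Real.exp u + 1) * (u + Real.exp (-u) - c) :=
    mul_le_mul (by linarith) (by linarith) h3.le (by positivity)
  have h5 : Real.exp u * Real.exp (-u) = 1 := by rw [← Real.exp_add]; simp
  nlinarith

theorem log_mul_one_sub_div_le {c u x : ℝ} (hc : 0 ≤ c) (hu : 0 < u) (hx : Real.exp u ≤ x) :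
    1 * (Real.log x + Real.log 1) * (1 - c / u) ≤ Real.log x - c := by
  have h1 : u ≤ Real.log x := (Real.le_log_iff_exp_le ((Real.exp_pos _).trans_le hx)).mpr hx
  have h2 : c ≤ c / u * Real.log x := by
    rw [div_mul_eq_mul_div, le_div_iff₀ hu]
    exact mul_le_mul_of_nonneg_left h1 hc
  rw [Real.log_one]
  linarith

theorem sum_exp_sub_one_le (m : ℕ) :
    ∑ j ∈ Finset.range (m + 1), (Real.exp j - 1) ≤ m * Real.exp m := by
  rw [Finset.sum_range_succ']
  simp only [Nat.cast_zero, Real.exp_zero, sub_self, add_zero]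
  calc ∑ j ∈ Finset.range m, (Real.exp ((j + 1 : ℕ) : ℝ) - 1)
      ≤ ∑ _j ∈ Finset.range m, Real.exp m := by
        refine Finset.sum_le_sum fun j hj => ?_
        have : ((j + 1 : ℕ) : ℝ) ≤ m := by exact_mod_cast Finset.mem_range.mp hj
        linarith [Real.exp_le_exp.mpr this]
    _ = m * Real.exp m := by simp

theorem abs_prod_erase_le {m : ℕ} (k : ℕ) (hk : k ≤ m) {x : ℝ} (hx : 0 ≤ x) (hxm : x ≤ m) :
    |∏ i ∈ (Finset.range (m + 1)).erase k, (x - i)| ≤ (m : ℝ) ^ m := by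
  have hcard : ((Finset.range (m + 1)).erase k).card = m := by
    rw [Finset.card_erase_of_mem (Finset.mem_range.mpr (by omega)), Finset.card_range]
    omega
  rw [Finset.abs_prod]
  calc ∏ i ∈ (Finset.range (m + 1)).erase k, |x - i|
      ≤ ∏ _i ∈ (Finset.range (m + 1)).erase k, (m : ℝ) := by
        refine Finset.prod_le_prod (fun i _ => abs_nonneg _) fun i hi => ?_
        have hi' : (i : ℝ) ≤ m := by
          exact_mod_cast Nat.lt_succ_iff.mp (Finset.mem_range.mp (Finset.mem_of_mem_erase hi))
        exact abs_le.mpr ⟨by linarith, by linarith [(Nat.cast_nonneg i : (0 : ℝ) ≤ i)]⟩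
    _ = (m : ℝ) ^ m := by rw [Finset.prod_const, hcard]

theorem abs_prod_two_le {x : ℝ} (hx : 0 ≤ x) (hx2 : x ≤ 2) :
    |∏ i ∈ Finset.range (2 + 1), (x - i)| ≤ 0.385 := by
  simp only [Finset.prod_range_succ, Finset.prod_range_zero]
  push_cast
  rw [abs_le]
  constructor
  · nlinarith [mul_nonneg hx (sq_nonneg (x - 1.577)), mul_nonneg (sub_nonneg.mpr hx2) (sq_nonneg (x - 1.577)), sq_nonneg (x - 1.577)]
  · nlinarith [mul_nonneg hx (sq_nonneg (x - 0.423)), mul_nonneg (sub_nonneg.mpr hx2) (sq_nonneg (x - 0.423)), sq_nonneg (x - 0.423)]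

theorem abs_prod_three_le {x : ℝ} (hx : 0 ≤ x) (hx3 : x ≤ 3) :
    |∏ i ∈ Finset.range (3 + 1), (x - i)| ≤ 1 := by
  simp only [Finset.prod_range_succ, Finset.prod_range_zero]
  push_cast
  have h : (1 * (x - 0) * (x - 1) * (x - 2) * (x - 3)) = ((x - 1.5) ^ 2 - 1.25) ^ 2 - 1 := by ring
  have hu : (x - 1.5) ^ 2 ≤ 2.25 := by nlinarith
  rw [h, abs_le]
  constructor
  · linarith [sq_nonneg ((x - 1.5) ^ 2 - 1.25)]
  · nlinarith [sq_nonneg (x - 1.5)]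

theorem abs_prod_four_le {x : ℝ} (hx : 0 ≤ x) (hx4 : x ≤ 4) :
    |∏ i ∈ Finset.range (4 + 1), (x - i)| ≤ 3.632 := by
  simp only [Finset.prod_range_succ, Finset.prod_range_zero]
  push_cast
  -- with `u = (x - 2)²`, the square of the product is `u (u - 1)² (u - 4)²`
  obtain ⟨u, hu⟩ : ∃ u, u = (x - 2) ^ 2 := ⟨_, rfl⟩
  have hu0 : 0 ≤ u := hu ▸ sq_nonneg _
  have hu4 : u ≤ 4 := by rw [hu]; nlinarith
  apply abs_le_of_sq_le_sq _ (by norm_num)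
  have h : (1 * (x - 0) * (x - 1) * (x - 2) * (x - 3) * (x - 4)) ^ 2 =
      u * (u - 1) ^ 2 * (u - 4) ^ 2 := by rw [hu]; ring
  rw [h]
  -- the maximum is attained near `u = 2.704`
  have hq : 0 ≤ -u ^ 3 + 4.592 * u ^ 2 - 0.854848 * u + 1.802 := by
    nlinarith [mul_nonneg (sq_nonneg u) (sub_nonneg.mpr hu4), sq_nonneg (u - 0.722)]
  nlinarith [mul_nonneg (sq_nonneg (u - 2.704)) hq]

theorem abs_prod_five_le {x : ℝ} (hx : 0 ≤ x) (hx5 : x ≤ 5) :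
    |∏ i ∈ Finset.range (5 + 1), (x - i)| ≤ 16.901 := by
  simp only [Finset.prod_range_succ, Finset.prod_range_zero]
  push_cast
  obtain ⟨u, hu⟩ : ∃ u, u = (x - 2.5) ^ 2 := ⟨_, rfl⟩
  have hu0 : 0 ≤ u := hu ▸ sq_nonneg _
  have hu4 : u ≤ 6.25 := by rw [hu]; nlinarith
  have h : 1 * (x - 0) * (x - 1) * (x - 2) * (x - 3) * (x - 4) * (x - 5) =
      (u - 6.25) * (u - 2.25) * (u - 0.25) := by rw [hu]; ring
  rw [h, abs_le]
  constructor
  · nlinarith [mul_nonneg hu0 (sq_nonneg (u - 4.6805)), sq_nonneg (u - 4.6805)]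
  · nlinarith [mul_nonneg (sub_nonneg.mpr hu4) (sq_nonneg (u - 1.15)), mul_nonneg (sub_nonneg.mpr hu4) hu0]

theorem abs_prod_three_erase_le (k : ℕ) (hk : k ≤ 3) {x : ℝ} (hx : 0 ≤ x) (hx3 : x ≤ 3) :
    |∏ i ∈ (Finset.range (3 + 1)).erase k, (x - i)| ≤ 6 := by
  have h0 : (Finset.range (3 + 1)).erase 0 = {1, 2, 3} := by decide
  have h1 : (Finset.range (3 + 1)).erase 1 = {0, 2, 3} := by decide
  have h2 : (Finset.range (3 + 1)).erase 2 = {0, 1, 3} := by decide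
  have h3 : (Finset.range (3 + 1)).erase 3 = {0, 1, 2} := by decide
  have hp := mul_nonneg hx (sub_nonneg.mpr hx3)
  interval_cases k
  · have h : ∏ i ∈ ({1, 2, 3} : Finset ℕ), (x - (i : ℝ)) = (x - 1) * ((x - 2) * (x - 3)) := by
      norm_num
    rw [h0, h, abs_le]
    constructor <;> nlinarith [mul_nonneg hx hp, mul_nonneg (sub_nonneg.mpr hx3) hp]
  · have h : ∏ i ∈ ({0, 2, 3} : Finset ℕ), (x - (i : ℝ)) = (x - 0) * ((x - 2) * (x - 3)) := by
      norm_num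
    rw [h1, h, abs_le]
    constructor <;> nlinarith [mul_nonneg hx hp, mul_nonneg (sub_nonneg.mpr hx3) hp]
  · have h : ∏ i ∈ ({0, 1, 3} : Finset ℕ), (x - (i : ℝ)) = (x - 0) * ((x - 1) * (x - 3)) := by
      norm_num
    rw [h2, h, abs_le]
    constructor <;> nlinarith [mul_nonneg hx hp, mul_nonneg (sub_nonneg.mpr hx3) hp]
  · have h : ∏ i ∈ ({0, 1, 2} : Finset ℕ), (x - (i : ℝ)) = (x - 0) * ((x - 1) * (x - 2)) := by
      norm_num
    rw [h3, h, abs_le]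
    constructor <;> nlinarith [mul_nonneg hx hp, mul_nonneg (sub_nonneg.mpr hx3) hp]

/-- From `m` to `m + 1` the maximum of `|x (x - 1) ⋯ (x - m)|` on `[0, m]` grows at most by the
factor `m + 1`: on `[0, m]` the new factor is at most `m + 1`, and `[m, m + 1]` is reflected
into `[0, 1]`. -/
theorem abs_prod_succ_le {m : ℕ} (hm : 1 ≤ m) {M : ℝ}
    (hM : ∀ x : ℝ, 0 ≤ x → x ≤ m → |∏ i ∈ Finset.range (m + 1), (x - i)| ≤ M) {x : ℝ}
    (hx : 0 ≤ x) (hxm : x ≤ (m + 1 : ℕ)) :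
    |∏ i ∈ Finset.range (m + 1 + 1), (x - i)| ≤ (m + 1) * M := by
  have hlow : ∀ x : ℝ, 0 ≤ x → x ≤ m →
      |∏ i ∈ Finset.range (m + 1 + 1), (x - i)| ≤ (m + 1) * M := by
    intro x hx hxm
    rw [Finset.prod_range_succ, abs_mul, mul_comm]
    refine mul_le_mul ?_ (hM x hx hxm) (abs_nonneg _) (by positivity)
    push_cast
    exact abs_le.mpr ⟨by linarith, by linarith⟩
  rcases le_total x m with h | h
  · exact hlow x hx h
  · have hm1 : (1 : ℝ) ≤ m := by exact_mod_cast hm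
    push_cast at hxm
    have h1 := hlow (m + 1 - x) (by linarith) (by linarith)
    rw [Finset.abs_prod] at h1 ⊢
    rw [← Finset.prod_range_reflect]
    refine le_trans (le_of_eq (Finset.prod_congr rfl fun i hi => ?_)) h1
    have hi' : i ≤ m + 1 := Nat.lt_succ_iff.mp (Finset.mem_range.mp hi)
    rw [show m + 1 + 1 - 1 - i = m + 1 - i by omega, Nat.cast_sub hi', ← abs_neg]
    push_cast
    congr 1
    ring

theorem abs_prod_le_factorial {m : ℕ} (hm : 5 ≤ m) {x : ℝ} (hx : 0 ≤ x) (hxm : x ≤ m) :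
    |∏ i ∈ Finset.range (m + 1), (x - i)| ≤ (m ! : ℝ) / 120 * Real.exp ((82 : ℕ) / (29 : ℕ)) := by
  induction m, hm using Nat.le_induction generalizing x with
  | base =>
    have h1 : (16.901 : ℝ) ≤ Real.exp ((82 : ℕ) / (29 : ℕ)) := le_exp_div (by norm_num) (by norm_num)
    have h2 := abs_prod_five_le hx (by exact_mod_cast hxm)
    refine (h2.trans h1).trans (le_of_eq ?_)
    norm_num [Nat.factorial]
  | succ m hm ih =>
    have h := abs_prod_succ_le (by omega : 1 ≤ m) (fun x hx hxm => ih hx hxm) hx hxm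
    refine h.trans (le_of_eq ?_)
    rw [Nat.factorial_succ]
    push_cast
    ring

/-! ### The cases `m = 2, 3, 4` -/

theorem minFloor_three_two : minFloor 3 2 = 1 := by decide

theorem minFloor_four_two : minFloor 4 2 = 1 := by decide

theorem floorSum_two : floorSum 2 = 0 := by decide

theorem floorSum_three : floorSum 3 = 1 := by decide

theorem floorSum_four : floorSum 4 = 1 := by decide

theorem kappaSum_two : kappaSum 2 = 0 := by
  have h : (Finset.Icc 1 ((2 + 1) / 2)).filter Nat.Prime = ∅ := by decide
  rw [kappaSum, h, Finset.sum_empty]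

theorem kappaSum_three : kappaSum 3 = Real.log 2 := by
  have h : (Finset.Icc 1 ((3 + 1) / 2)).filter Nat.Prime = {2} := by decide
  rw [kappaSum, h, Finset.sum_singleton, minFloor_three_two]
  norm_num

theorem kappaSum_four : kappaSum 4 = Real.log 2 := by
  have h : (Finset.Icc 1 ((4 + 1) / 2)).filter Nat.Prime = {2} := by decide
  rw [kappaSum, h, Finset.sum_singleton, minFloor_four_two]
  norm_num

section

variable {K : Type*} [Field K] [NumberField K] [NumberField.IsTotallyComplex K]

set_option exponentiation.threshold 300 in
theorem lower_bound_two (hK : Module.finrank ℚ K = 2) (ψ : K →+* ℂ) {H : ℝ} (hH0 : 0 < H)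
    (hH : s 2 * Real.exp (s 2) ≤ Real.log H)
    {lam : Fin (2 + 1) → NumberField.RingOfIntegers K} (hlam : lam ≠ 0)
    (hlamH : ∀ j : Fin (2 + 1), j ≠ 0 → ‖ψ (lam j)‖ ≤ H) :
    1 / (2 * Real.exp (D 2)) * (2 * H) ^ (-((2 : ℕ) : ℝ) - eps 2 H)
      < ‖∑ j : Fin (2 + 1), ψ (lam j) * Complex.exp 1 ^ (j : ℕ)‖ := by
  have hs : s 2 = Real.exp 1 := by simp [s]
  have hd : d 2 = 0.3654 := by simp [d]
  have hB : B 2 = 2.4099 := by simp [B]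
  have hD : D 2 = 3.8111 := by simp [D]
  have he1 := Real.exp_one_gt_d9
  have he2 := Real.exp_one_lt_d9
  have hexps : 15.1516 ≤ Real.exp (s 2) := by
    have h1 : (15.1516 : ℝ) ≤ Real.exp ((299 : ℕ) / (110 : ℕ)) :=
      le_exp_div (by norm_num) (by norm_num)
    refine h1.trans (Real.exp_le_exp.mpr ?_)
    rw [hs]; norm_num; linarith
  have hexpneg : Real.exp (-s 2) ≤ 1 / 15.1516 := by
    rw [Real.exp_neg, ← one_div]
    exact one_div_le_one_div_of_le (by norm_num) hexps
  have hM : 0.385 ≤ Real.exp (-0.95) := by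
    have h1 : Real.exp ((19 : ℕ) / (20 : ℕ)) ≤ 1 / 0.385 :=
      exp_div_le (by norm_num) (by norm_num) (by norm_num)
    rw [Real.exp_neg, show (0.95 : ℝ) = (19 : ℕ) / (20 : ℕ) by norm_num, ← one_div,
      le_one_div (by norm_num) (Real.exp_pos _)]
    exact h1
  have hE : ∑ j ∈ Finset.range (2 + 1), (Real.exp j - 1) ≤ Real.exp 2.1 := by
    have h1 : (8.11 : ℝ) ≤ Real.exp ((21 : ℕ) / (10 : ℕ)) := le_exp_div (by norm_num) (by norm_num)
    rw [show (((21 : ℕ) : ℝ) / (10 : ℕ)) = 2.1 by norm_num] at h1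
    have h2 : Real.exp 2 = Real.exp 1 * Real.exp 1 := by rw [← Real.exp_add]; norm_num
    simp only [Finset.sum_range_succ, Finset.sum_range_zero]
    norm_num
    nlinarith
  have hlog3 : Real.log ((2 : ℕ) + 1) = Real.log 3 := by norm_num
  have hlog3u := Real.log_three_lt_d9
  have hlog3l := Real.log_three_gt_d9
  have hlog2u := Real.log_two_lt_d9
  have hlog2l := Real.log_two_gt_d9
  refine lower_bound_of_parameters hK ψ (by norm_num) hH0 hH hlam hlamH (M := Real.exp (-0.95))
    (A := (2 : ℕ) ^ 2) (E := Real.exp 2.1) (d' := d 2) (r := 1) (n₀ := 16) (Real.exp_pos _)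
    (by norm_num) (Real.exp_pos _) one_pos
    (fun x hx hx2 => (abs_prod_two_le hx (by exact_mod_cast hx2)).trans hM)
    (fun k hk x hx hx2 => abs_prod_erase_le k hk hx hx2) hE (by rw [hs]; positivity)
    (by rw [hs, hd]; linarith) (by rw [hB]; norm_num) ?_ (by norm_num) ?_ ?_ ?_ ?_
  · rw [hB, hd, hD]
    norm_num at hexpneg ⊢
    linarith
  · intro n hn
    have h1 : Real.exp (s 2) ≤ n - 1 := by
      refine exp_le_sub_one_of_le_mul_log_sub (by rw [hs]; positivity) hn ?_
      rw [hd]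
      rw [hs] at hexps hexpneg ⊢
      norm_num at hexpneg ⊢
      linarith
    refine ⟨?_, h1⟩
    have h2 : (15 : ℝ) < n := by linarith
    have h3 : 15 < n := by exact_mod_cast h2
    omega
  · intro n hn _
    have hn' : (16 : ℝ) ≤ n := by exact_mod_cast hn
    have h16 : (16 : ℝ) ≤ Real.exp 2.8 := by
      have h1 : (16 : ℝ) ≤ Real.exp ((28 : ℕ) / (10 : ℕ)) :=
        le_exp_div (by norm_num) (by norm_num)
      rwa [show (((28 : ℕ) : ℝ) / (10 : ℕ)) = 2.8 by norm_num] at h1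
    have h2 := log_le_tangent (t := (n : ℝ)) (by norm_num) h16 (by linarith)
    have h4 : Real.log (((2 : ℕ) : ℝ) ^ 2) = 2 * Real.log 2 := by
      rw [Real.log_pow]; norm_num
    rw [floorSum_two, kappaSum_two, Real.log_exp, Real.log_exp, h4, hd]
    norm_num
    linarith
  · intro n _ hx
    exact log_mul_one_sub_div_le (by rw [hd]; norm_num) (by rw [hs]; positivity) hx
  · intro n hn _
    have hn' : (16 : ℝ) ≤ n := by exact_mod_cast hn
    rw [floorSum_two, kappaSum_two, hlog3, hd, hB, Real.log_one]
    norm_num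
    nlinarith

theorem lower_bound_three (hK : Module.finrank ℚ K = 2) (ψ : K →+* ℂ) {H : ℝ} (hH0 : 0 < H)
    (hH : s 3 * Real.exp (s 3) ≤ Real.log H)
    {lam : Fin (3 + 1) → NumberField.RingOfIntegers K} (hlam : lam ≠ 0)
    (hlamH : ∀ j : Fin (3 + 1), j ≠ 0 → ‖ψ (lam j)‖ ≤ H) :
    1 / (2 * Real.exp (D 3)) * (2 * H) ^ (-((3 : ℕ) : ℝ) - eps 3 H)
      < ‖∑ j : Fin (3 + 1), ψ (lam j) * Complex.exp 1 ^ (j : ℕ)‖ := by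
  have hs : s 3 = 3 * Real.log 3 ^ 2 := by simp [s]
  have hd : d 3 = 0.5139 := by simp [d]
  have hB : B 3 = 3.6433 := by simp [B]
  have hD : D 3 = 5.1819 := by simp [D]
  have hlog3u := Real.log_three_lt_d9
  have hlog3l := Real.log_three_gt_d9
  have hlog2u := Real.log_two_lt_d9
  have hlog2l := Real.log_two_gt_d9
  have hsl : 3.6207 ≤ s 3 := by rw [hs]; nlinarith
  have hsu : s 3 ≤ 3.62085 := by rw [hs]; nlinarith
  have he1 := Real.exp_one_gt_d9
  have he2 := Real.exp_one_lt_d9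
  have hexps : 37.36 ≤ Real.exp (s 3) := by
    have h1 : (37.36 : ℝ) ≤ Real.exp ((105 : ℕ) / (29 : ℕ)) :=
      le_exp_div (by norm_num) (by norm_num)
    refine h1.trans (Real.exp_le_exp.mpr ?_)
    norm_num at hsl ⊢; linarith
  have hexpneg : Real.exp (-s 3) ≤ 1 / 37.36 := by
    rw [Real.exp_neg, ← one_div]
    exact one_div_le_one_div_of_le (by norm_num) hexps
  have hE : ∑ j ∈ Finset.range (3 + 1), (Real.exp j - 1) ≤ Real.exp 3.3125 := by
    have h1 : (27.2 : ℝ) ≤ Real.exp ((53 : ℕ) / (16 : ℕ)) :=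
      le_exp_div (by norm_num) (by norm_num)
    rw [show (((53 : ℕ) : ℝ) / (16 : ℕ)) = 3.3125 by norm_num] at h1
    have h2 : Real.exp 2 ≤ 7.38906 := by
      have := exp_div_le (a := 7.38906) (j := 2) (k := 1) (by norm_num) (by norm_num) (by norm_num)
      norm_num at this ⊢; exact this
    have h3 : Real.exp 3 ≤ 20.0856 := by
      have := exp_div_le (a := 20.0856) (j := 3) (k := 1) (by norm_num) (by norm_num) (by norm_num)
      norm_num at this ⊢; exact this
    simp only [Finset.sum_range_succ, Finset.sum_range_zero]
    norm_num at h1 h2 h3 ⊢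
    linarith
  have hlog4 : Real.log ((3 : ℕ) + 1) = 2 * Real.log 2 := by
    rw [← Real.log_four_eq]; norm_num
  have hlog6 : Real.log 6 = Real.log 2 + Real.log 3 := by
    rw [← Real.log_mul (by norm_num) (by norm_num)]; norm_num
  -- The remainder condition at `n = 43` fails for `d' = d 3` and forces `d'` to exceed it slightly;
  -- with this `d'` one still has `z ≥ 0.994 (n - 1)`.
  refine lower_bound_of_parameters hK ψ (by norm_num) hH0 hH hlam hlamH (M := 1)
    (A := 6) (E := Real.exp 3.3125) (d' := 0.5489) (r := 0.994) (n₀ := 43) one_pos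
    (by norm_num) (Real.exp_pos _) (by norm_num)
    (fun x hx hx2 => abs_prod_three_le hx (by exact_mod_cast hx2))
    (fun k hk x hx hx2 => abs_prod_three_erase_le k hk hx (by exact_mod_cast hx2)) hE
    (by linarith) (by rw [hd]; linarith) (by rw [hB]; norm_num) ?_ (by norm_num) ?_ ?_ ?_ ?_
  · rw [hB, hd, hD]
    norm_num at hexpneg ⊢
    linarith
  · intro n hn
    have h1 : Real.exp (s 3) ≤ n - 1 := by
      refine exp_le_sub_one_of_le_mul_log_sub (by linarith) hn ?_
      norm_num at hexpneg ⊢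
      linarith
    refine ⟨?_, h1⟩
    have h42 : ((42 : ℕ) : ℝ) ≤ Real.exp 3.74 := by
      have h1 : (42 : ℝ) ≤ Real.exp ((187 : ℕ) / (50 : ℕ)) :=
        le_exp_div (by norm_num) (by norm_num)
      rw [show (((187 : ℕ) : ℝ) / (50 : ℕ)) = 3.74 by norm_num] at h1
      exact_mod_cast h1
    have hT : 135 ≤ s 3 * Real.exp (s 3) := by nlinarith
    by_contra! hlt
    have hnR : (n : ℝ) ≤ 42 := by exact_mod_cast Nat.lt_succ_iff.mp hlt
    have hn0 : (0 : ℝ) < n := by linarith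
    have h4 : Real.log n ≤ 3.74 :=
      (Real.log_le_iff_le_exp hn0).mpr (hnR.trans (by exact_mod_cast h42))
    nlinarith
  · intro n hn _
    have hn' : (43 : ℝ) ≤ n := by exact_mod_cast hn
    have h43 : (43 : ℝ) ≤ Real.exp 3.78 := by
      have h1 : (43 : ℝ) ≤ Real.exp ((189 : ℕ) / (50 : ℕ)) :=
        le_exp_div (by norm_num) (by norm_num)
      rwa [show (((189 : ℕ) : ℝ) / (50 : ℕ)) = 3.78 by norm_num] at h1
    have h44 : (44 : ℝ) ≤ Real.exp 3.8 := by
      have h1 : (44 : ℝ) ≤ Real.exp ((19 : ℕ) / (5 : ℕ)) :=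
        le_exp_div (by norm_num) (by norm_num)
      rwa [show (((19 : ℕ) : ℝ) / (5 : ℕ)) = 3.8 by norm_num] at h1
    have h2 := log_le_tangent (t := (n : ℝ)) (by norm_num) h43 (by linarith)
    have h3 := log_le_tangent (t := (n : ℝ) + 1) (by norm_num) h44 (by linarith)
    rw [floorSum_three, kappaSum_three, Real.log_exp, Real.log_one, hlog6]
    norm_num at h2 h3 ⊢
    nlinarith
  · intro n hn _
    have hn' : (42 : ℝ) ≤ n - 1 := by
      have : (43 : ℝ) ≤ n := by exact_mod_cast hn
      linarith
    have h1 : 3.7 ≤ Real.log ((n : ℝ) - 1) := by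
      rw [Real.le_log_iff_exp_le (by linarith)]
      have h2 := exp_div_le (a := 42) (j := 37) (k := 10) (by norm_num) (by norm_num) (by norm_num)
      rw [show (((37 : ℕ) : ℝ) / (10 : ℕ)) = 3.7 by norm_num] at h2
      linarith
    have h2 : Real.log (0.994 : ℝ) ≤ -0.006 := by
      have := Real.log_le_sub_one_of_pos (show (0 : ℝ) < 0.994 by norm_num)
      norm_num at this ⊢; linarith
    have h3 : 0.141928 ≤ d 3 / s 3 := by
      rw [hd, le_div_iff₀ (by linarith)]; norm_num at hsu ⊢; linarith
    have h4 : 0.994 * (Real.log ((n : ℝ) - 1) + Real.log 0.994) ≤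
        0.994 * (Real.log ((n : ℝ) - 1) - 0.006) := by linarith
    have h5 : d 3 / s 3 ≤ 1 := by rw [hd, div_le_one (by linarith)]; linarith
    calc _ ≤ 0.994 * (Real.log ((n : ℝ) - 1) - 0.006) * (1 - d 3 / s 3) :=
          mul_le_mul_of_nonneg_right h4 (by linarith)
      _ ≤ 0.994 * (Real.log ((n : ℝ) - 1) - 0.006) * (1 - 0.141928) :=
          mul_le_mul_of_nonneg_left (by linarith) (by linarith)
      _ ≤ _ := by linarith
  · intro n hn _
    have hn' : (43 : ℝ) ≤ n := by exact_mod_cast hn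
    have h44 : (44 : ℝ) ≤ Real.exp 3.8 := by
      have h1 : (44 : ℝ) ≤ Real.exp ((19 : ℕ) / (5 : ℕ)) :=
        le_exp_div (by norm_num) (by norm_num)
      rwa [show (((19 : ℕ) : ℝ) / (5 : ℕ)) = 3.8 by norm_num] at h1
    have h3 := log_le_tangent (t := (n : ℝ) + 1) (by norm_num) h44 (by linarith)
    have h4 : -0.0061 ≤ Real.log (0.994 : ℝ) := by
      have := Real.one_sub_inv_le_log_of_pos (show (0 : ℝ) < 0.994 by norm_num)
      norm_num at this ⊢; linarith
    rw [floorSum_three, kappaSum_three, hlog4, hd, hB]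
    norm_num at h3 h4 ⊢
    nlinarith

theorem lower_bound_four (hK : Module.finrank ℚ K = 2) (ψ : K →+* ℂ) {H : ℝ} (hH0 : 0 < H)
    (hH : s 4 * Real.exp (s 4) ≤ Real.log H)
    {lam : Fin (4 + 1) → NumberField.RingOfIntegers K} (hlam : lam ≠ 0)
    (hlamH : ∀ j : Fin (4 + 1), j ≠ 0 → ‖ψ (lam j)‖ ≤ H) :
    1 / (2 * Real.exp (D 4)) * (2 * H) ^ (-((4 : ℕ) : ℝ) - eps 4 H)
      < ‖∑ j : Fin (4 + 1), ψ (lam j) * Complex.exp 1 ^ (j : ℕ)‖ := by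
  have hs : s 4 = 16 * Real.log 2 ^ 2 := by
    simp only [s]
    norm_num
    rw [Real.log_four_eq]
    ring
  have hd : d 4 = 1.6016 := by simp [d]
  have hB : B 4 = 9.7676 := by simp [B]
  have hD : D 4 = 7.3631 := by simp [D]
  have hlog2u := Real.log_two_lt_d9
  have hlog2l := Real.log_two_gt_d9
  have hlog5u := Real.log_five_lt_d9
  have hlog5l := Real.log_five_gt_d9
  have hsl : 7.6872 ≤ s 4 := by rw [hs]; nlinarith
  have hsu : s 4 ≤ 7.68726 := by rw [hs]; nlinarith
  have hexps : 2164 ≤ Real.exp (s 4) := by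
    have h1 : (2164 : ℝ) ≤ Real.exp ((192 : ℕ) / (25 : ℕ)) :=
      le_exp_div (by norm_num) (by norm_num)
    refine h1.trans (Real.exp_le_exp.mpr ?_)
    norm_num at hsl ⊢; linarith
  have hexpneg : Real.exp (-s 4) ≤ 1 / 2164 := by
    rw [Real.exp_neg, ← one_div]
    exact one_div_le_one_div_of_le (by norm_num) hexps
  have hM : 3.632 ≤ Real.exp 1.29 := by
    have h1 : (3.632 : ℝ) ≤ Real.exp ((129 : ℕ) / (100 : ℕ)) :=
      le_exp_div (by norm_num) (by norm_num)
    rwa [show (((129 : ℕ) : ℝ) / (100 : ℕ)) = 1.29 by norm_num] at h1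
  have hlog4 : Real.log 4 = 2 * Real.log 2 := Real.log_four_eq
  have hlog5 : Real.log ((4 : ℕ) + 1) = Real.log 5 := by norm_num
  have hlogE : Real.log (((4 : ℕ) : ℝ) * Real.exp ((4 : ℕ) : ℝ)) = 2 * Real.log 2 + 4 := by
    rw [Real.log_mul (by norm_num) (Real.exp_ne_zero _), Real.log_exp]
    push_cast
    rw [hlog4]
  have hlogA : Real.log (((4 : ℕ) : ℝ) ^ 4) = 8 * Real.log 2 := by
    rw [Real.log_pow]; push_cast; rw [hlog4]; ring
  -- The remainder condition at `n = 2600` fails for `d' = d 4`. On the range of `n` one has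
  -- `log (n - 1) ≥ 7.85 > s 4`, which leaves room for the factor `1.004` in the bound for `z`.
  refine lower_bound_of_parameters hK ψ (by norm_num) hH0 hH hlam hlamH (M := Real.exp 1.29)
    (A := (4 : ℕ) ^ 4) (E := (4 : ℕ) * Real.exp (4 : ℕ)) (d' := 1.6056) (r := 1.004) (n₀ := 2600)
    (Real.exp_pos _) (by norm_num) (by positivity) (by norm_num)
    (fun x hx hx2 => (abs_prod_four_le hx (by exact_mod_cast hx2)).trans hM)
    (fun k hk x hx hx2 => abs_prod_erase_le k hk hx hx2) (sum_exp_sub_one_le 4)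
    (by linarith) (by rw [hd]; linarith) (by rw [hB]; norm_num) ?_ (by norm_num) ?_ ?_ ?_ ?_
  · rw [hB, hd, hD]
    norm_num at hexpneg ⊢
    linarith
  · intro n hn
    have h1 : Real.exp (s 4) ≤ n - 1 := by
      refine exp_le_sub_one_of_le_mul_log_sub (by linarith) hn ?_
      norm_num at hexpneg ⊢
      linarith
    refine ⟨?_, h1⟩
    have h2600 : ((2600 : ℕ) : ℝ) ≤ Real.exp 7.875 := by
      have h1 : (2600 : ℝ) ≤ Real.exp ((63 : ℕ) / (8 : ℕ)) :=
        le_exp_div (by norm_num) (by norm_num)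
      rw [show (((63 : ℕ) : ℝ) / (8 : ℕ)) = 7.875 by norm_num] at h1
      exact_mod_cast h1
    have hT : 16600 ≤ s 4 * Real.exp (s 4) := by nlinarith
    refine le_of_le_mul_log_sub hn (by linarith) h2600 ?_
    norm_num
    linarith
  · intro n hn _
    have hn' : (2600 : ℝ) ≤ n := by exact_mod_cast hn
    have h2601 : (2601 : ℝ) ≤ Real.exp 7.875 := by
      have h1 : (2601 : ℝ) ≤ Real.exp ((63 : ℕ) / (8 : ℕ)) :=
        le_exp_div (by norm_num) (by norm_num)
      rwa [show (((63 : ℕ) : ℝ) / (8 : ℕ)) = 7.875 by norm_num] at h1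
    have h2 := log_le_tangent (t := (n : ℝ)) (by norm_num) h2601 (by linarith)
    have h3 := log_le_tangent (t := (n : ℝ) + 1) (by norm_num) h2601 (by linarith)
    rw [floorSum_four, kappaSum_four, Real.log_exp, hlogE, hlogA]
    norm_num at h2 h3 ⊢
    nlinarith
  · intro n hn _
    have hn' : (2599 : ℝ) ≤ n - 1 := by
      have : (2600 : ℝ) ≤ n := by exact_mod_cast hn
      linarith
    have h1 : 7.85 ≤ Real.log ((n : ℝ) - 1) := by
      rw [Real.le_log_iff_exp_le (by linarith)]
      have h2 := exp_div_le (a := 2599) (j := 157) (k := 20) (by norm_num) (by norm_num)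
        (by norm_num)
      rw [show (((157 : ℕ) : ℝ) / (20 : ℕ)) = 7.85 by norm_num] at h2
      linarith
    have h2 : Real.log (1.004 : ℝ) ≤ 0.004 := by
      have := Real.log_le_sub_one_of_pos (show (0 : ℝ) < 1.004 by norm_num)
      norm_num at this ⊢; linarith
    have h3 : 0.208344 ≤ d 4 / s 4 := by
      rw [hd, le_div_iff₀ (by linarith)]; norm_num at hsu ⊢; linarith
    have h4 : 1.004 * (Real.log ((n : ℝ) - 1) + Real.log 1.004) ≤
        1.004 * (Real.log ((n : ℝ) - 1) + 0.004) := by linarith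
    have h5 : d 4 / s 4 ≤ 1 := by rw [hd, div_le_one (by linarith)]; linarith
    calc _ ≤ 1.004 * (Real.log ((n : ℝ) - 1) + 0.004) * (1 - d 4 / s 4) :=
          mul_le_mul_of_nonneg_right h4 (by linarith)
      _ ≤ 1.004 * (Real.log ((n : ℝ) - 1) + 0.004) * (1 - 0.208344) :=
          mul_le_mul_of_nonneg_left (by linarith) (by linarith)
      _ ≤ _ := by linarith
  · intro n hn _
    have hn' : (2600 : ℝ) ≤ n := by exact_mod_cast hn
    have h2601 : (2601 : ℝ) ≤ Real.exp 7.875 := by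
      have h1 : (2601 : ℝ) ≤ Real.exp ((63 : ℕ) / (8 : ℕ)) :=
        le_exp_div (by norm_num) (by norm_num)
      rwa [show (((63 : ℕ) : ℝ) / (8 : ℕ)) = 7.875 by norm_num] at h1
    have h3 := log_le_tangent (t := (n : ℝ) + 1) (by norm_num) h2601 (by linarith)
    have h4 : 0 ≤ Real.log (1.004 : ℝ) := Real.log_nonneg (by norm_num)
    rw [floorSum_four, kappaSum_four, hlog5, hd, hB]
    norm_num at h3 h4 ⊢
    nlinarith

end

/-! ### The constants for `m ≥ 5` -/

theorem s_of_five_le {m : ℕ} (hm : 5 ≤ m) : s m = m * Real.log m ^ 2 := by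
  rw [s, if_neg (by omega)]

theorem d_of_five_le {m : ℕ} (hm : 5 ≤ m) :
    d m = (m + 1 / 2) * Real.log m - (1 + kappa m) * m - 0.02394 := by
  rw [d, if_neg (by omega), if_neg (by omega), if_neg (by omega)]

theorem B_sub_mul_d {m : ℕ} (hm : 5 ≤ m) :
    B m - m * d m = (m + 1) * Real.log (m + 1) - (1 + kappa m) * m + 0.0000525 := by
  rw [B, if_neg (by omega), if_neg (by omega), if_neg (by omega), d_of_five_le hm]
  ring

theorem add_B_sub_mul_d_eq_D {m : ℕ} (hm : 5 ≤ m) :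
    m + (B m - m * d m) + m * Real.exp (-s m) = D m := by
  rw [B_sub_mul_d hm, D, if_neg (by omega), if_neg (by omega), if_neg (by omega), Real.exp_neg]
  ring

theorem log_ge_of_five_le {m : ℕ} (hm : 5 ≤ m) : 1.6 ≤ Real.log m := by
  have h : Real.log 5 ≤ Real.log m := Real.log_le_log (by norm_num) (by exact_mod_cast hm)
  linarith [Real.log_five_gt_d9]

theorem log_six : Real.log 6 = Real.log 2 + Real.log 3 := by
  rw [← Real.log_mul (by norm_num) (by norm_num)]; norm_num

theorem log_ge_of_six_le {m : ℕ} (hm : 6 ≤ m) : 1.79175 ≤ Real.log m := by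
  have h : Real.log 6 ≤ Real.log m := Real.log_le_log (by norm_num) (by exact_mod_cast hm)
  rw [log_six] at h
  linarith [Real.log_two_gt_d9, Real.log_three_gt_d9]

theorem kappa_mul (m : ℕ) (hm : 1 ≤ m) : kappa m * m =
    ∑ p ∈ (Finset.Icc 1 ((m + 1) / 2)).filter Nat.Prime,
      (minFloor m p : ℝ) * (Real.log p / (p - 1)) * w p (s m * Real.exp (s m)) := by
  have hm0 : (m : ℝ) ≠ 0 := Nat.cast_ne_zero.mpr (by omega)
  rw [kappa]
  field_simp

theorem w_le_one {p : ℕ} (hp : p.Prime) {x : ℝ} (hx : 1 ≤ x) : w p x ≤ 1 := by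
  have hp1 : (1 : ℝ) ≤ p := by exact_mod_cast hp.one_le
  have h1 : 0 ≤ (p : ℝ) / x := by positivity
  have h2 : 0 ≤ ((p : ℝ) - 1) / Real.log p * (Real.log x / x) :=
    mul_nonneg (div_nonneg (by linarith) (Real.log_nonneg hp1))
      (div_nonneg (Real.log_nonneg hx) (by linarith))
  rw [w]
  linarith

theorem w_nonneg {p : ℕ} (hp : p.Prime) {x : ℝ} (hx : 16 * (p : ℝ) ^ 2 ≤ x) : 0 ≤ w p x := by
  have hp2 : (2 : ℝ) ≤ p := by exact_mod_cast hp.two_le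
  have hx0 : 0 < x := by nlinarith
  set y := Real.sqrt x with hy
  have hy2 : y * y = x := Real.mul_self_sqrt hx0.le
  have hyp : 4 * (p : ℝ) ≤ y := by
    apply Real.le_sqrt_of_sq_le; linarith
  have hy0 : 0 < y := by linarith
  have hlog : Real.log x ≤ y := by
    have h1 : Real.log y ≤ y / 2 := by
      have h2 := Real.log_le_sub_one_of_pos (show 0 < y / 2 by positivity)
      rw [Real.log_div hy0.ne' two_ne_zero] at h2
      linarith [Real.log_two_lt_d9]
    rw [← hy2, Real.log_mul hy0.ne' hy0.ne']
    linarith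
  have h1 : (p : ℝ) / x ≤ 1 / 4 := by
    rw [div_le_iff₀ hx0]; nlinarith
  have h2 : Real.log x / x ≤ 1 / y := by
    rw [div_le_div_iff₀ hx0 hy0, one_mul]
    nlinarith
  have hlp : 0.5 ≤ Real.log p := by
    have := Real.log_le_log (by norm_num) hp2
    linarith [Real.log_two_gt_d9]
  have h3 : ((p : ℝ) - 1) / Real.log p ≤ 2 * p := by
    rw [div_le_iff₀ (by linarith)]; nlinarith
  have h4 : ((p : ℝ) - 1) / Real.log p * (Real.log x / x) ≤ 2 * p * (1 / y) :=
    mul_le_mul h3 h2 (div_nonneg (Real.log_nonneg (by nlinarith)) hx0.le) (by positivity)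
  have h5 : 2 * (p : ℝ) * (1 / y) ≤ 1 / 2 := by
    rw [mul_one_div, div_le_iff₀ hy0]; linarith
  rw [w]
  linarith

theorem minFloor_mul_log_nonneg {m p : ℕ} (hp : p.Prime) :
    0 ≤ (minFloor m p : ℝ) * (Real.log p / (p - 1)) := by
  have hp1 : (1 : ℝ) ≤ p := by exact_mod_cast hp.one_le
  exact mul_nonneg (Nat.cast_nonneg _) (div_nonneg (Real.log_nonneg hp1) (by linarith))

theorem kappa_mul_le_kappaSum {m : ℕ} (hm : 1 ≤ m) (hs : 1 ≤ s m * Real.exp (s m)) :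
    kappa m * m ≤ kappaSum m := by
  rw [kappa_mul m hm, kappaSum]
  refine Finset.sum_le_sum fun p hp => ?_
  have hp' := (Finset.mem_filter.mp hp).2
  exact mul_le_of_le_one_right (minFloor_mul_log_nonneg hp') (w_le_one hp' hs)

theorem kappa_mul_nonneg {m : ℕ} (hm : 1 ≤ m)
    (hs : 16 * (m : ℝ) ^ 2 ≤ s m * Real.exp (s m)) : 0 ≤ kappa m * m := by
  rw [kappa_mul m hm]
  refine Finset.sum_nonneg fun p hp => ?_
  obtain ⟨hpI, hp'⟩ := Finset.mem_filter.mp hp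
  have hpm : (p : ℝ) ≤ m := by
    have := (Finset.mem_Icc.mp hpI).2
    exact_mod_cast (by omega : p ≤ m)
  exact mul_nonneg (minFloor_mul_log_nonneg hp') (w_nonneg hp' (le_trans (by gcongr) hs))

theorem mul_le_s {m : ℕ} (hm : 5 ≤ m) : 2.56 * (m : ℝ) ≤ s m := by
  have h1 := log_ge_of_five_le hm
  rw [s_of_five_le hm]
  have hm0 : (0 : ℝ) ≤ m := Nat.cast_nonneg m
  have h2 : 2.56 ≤ Real.log m ^ 2 := by nlinarith
  nlinarith

theorem sq_le_s_mul_exp {m : ℕ} (hm : 5 ≤ m) : 16 * (m : ℝ) ^ 2 ≤ s m * Real.exp (s m) := by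
  have h1 := mul_le_s hm
  have hmR : (5 : ℝ) ≤ m := by exact_mod_cast hm
  have h2 : 1 + s m + s m ^ 2 / 2 ≤ Real.exp (s m) := Real.quadratic_le_exp_of_nonneg (by linarith)
  nlinarith [mul_le_mul h1 h2 (by nlinarith) (by linarith : 0 ≤ s m)]

theorem d_lt_s {m : ℕ} (hm : 5 ≤ m) : d m < s m := by
  have h1 := log_ge_of_five_le hm
  have hmR : (5 : ℝ) ≤ m := by exact_mod_cast hm
  have h2 := kappa_mul_nonneg (by omega) (sq_le_s_mul_exp hm)
  have h3 : Real.log m ≤ m - 1 := Real.log_le_sub_one_of_pos (by linarith)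
  have h4 : (m : ℝ) * Real.log m * 1 ≤ m * Real.log m * Real.log m :=
    mul_le_mul_of_nonneg_left (by linarith) (by nlinarith)
  rw [s_of_five_le hm, d_of_five_le hm]
  nlinarith

theorem pow_dvd_factorial_mul {p : ℕ} (hp : 0 < p) (k : ℕ) : p ^ k ∣ (p * k)! := by
  induction k with
  | zero => simp
  | succ k ih =>
    have h1 : (p * (k + 1))! = p * (k + 1) * (p * (k + 1) - 1)! :=
      (Nat.mul_factorial_pred (Nat.mul_pos hp k.succ_pos).ne').symm
    rw [h1, pow_succ, mul_comm (p ^ k)]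
    refine mul_dvd_mul (Dvd.intro _ rfl) (ih.trans (Nat.factorial_dvd_factorial ?_))
    rw [mul_add, mul_one]
    omega

/-- As `∏ p^{minFloor m p}` divides `m!`, the sum of `minFloor m p * log p` is at most `log m!`. For
the primes `p ≥ 3` the weight `1/(p - 1)` is at most `1/2`, and `minFloor m 2 ≤ m/2`. -/
theorem kappaSum_le (m : ℕ) :
    kappaSum m ≤ m / 4 * Real.log 2 + 1 / 2 * Real.log (m !) := by
  set P := (Finset.Icc 1 ((m + 1) / 2)).filter Nat.Prime with hP
  have hmf : ∀ p, minFloor m p ≤ m / p := fun p => by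
    simpa using minFloor_le p (Nat.zero_le m)
  have hdvd : ∏ p ∈ P, p ^ minFloor m p ∣ m ! := by
    refine Finset.prod_dvd_of_isRelPrime ?_ fun p hp => ?_
    · intro p hp q hq hpq
      have hp' := (Finset.mem_filter.mp (Finset.mem_coe.mp hp)).2
      have hq' := (Finset.mem_filter.mp (Finset.mem_coe.mp hq)).2
      exact Nat.coprime_iff_isRelPrime.mp
        (Nat.Coprime.pow _ _ ((Nat.coprime_primes hp' hq').mpr hpq))
    · have hp' := (Finset.mem_filter.mp hp).2
      have : p ^ (m / p) ∣ m ! := by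
        have h1 : p * (m / p) ≤ m := Nat.mul_div_le m p
        refine Dvd.dvd.trans ?_ (Nat.factorial_dvd_factorial h1)
        exact pow_dvd_factorial_mul hp'.pos _
      exact (pow_dvd_pow p (hmf p)).trans this
  have hlog : ∑ p ∈ P, (minFloor m p : ℝ) * Real.log p ≤ Real.log (m !) := by
    have h1 : ((∏ p ∈ P, p ^ minFloor m p : ℕ) : ℝ) ≤ (m ! : ℝ) := by
      exact_mod_cast Nat.le_of_dvd (Nat.factorial_pos m) hdvd
    have hne : ∀ p ∈ P, (p : ℝ) ^ minFloor m p ≠ 0 := fun p hp =>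
      pow_ne_zero _ (Nat.cast_ne_zero.mpr (Finset.mem_filter.mp hp).2.ne_zero)
    have hpos : (0 : ℝ) < ∏ p ∈ P, (p : ℝ) ^ minFloor m p := Finset.prod_pos fun p hp =>
      pow_pos (Nat.cast_pos.mpr (Finset.mem_filter.mp hp).2.pos) _
    push_cast at h1
    have h2 := Real.log_le_log hpos h1
    rw [Real.log_prod hne] at h2
    simpa only [Real.log_pow] using h2
  have hterm : ∀ p ∈ P, (minFloor m p : ℝ) * (Real.log p / (p - 1)) ≤
      1 / 2 * (minFloor m p * Real.log p) + if p = 2 then m / 4 * Real.log 2 else 0 := by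
    intro p hp
    have hp' := (Finset.mem_filter.mp hp).2
    have hl : 0 ≤ Real.log (p : ℝ) := Real.log_natCast_nonneg p
    have hc : (0 : ℝ) ≤ minFloor m p := Nat.cast_nonneg _
    split_ifs with h
    · subst h
      have h1 : (minFloor m 2 : ℝ) ≤ m / 2 :=
        (Nat.cast_le.mpr (hmf 2)).trans (by exact_mod_cast Nat.cast_div_le (α := ℝ))
      push_cast at hl ⊢
      norm_num
      nlinarith
    · have h3 : 3 ≤ p := by have := hp'.two_le; omega
      have h3R : (3 : ℝ) ≤ p := by exact_mod_cast h3
      have h4 : Real.log p / (p - 1) ≤ Real.log p / 2 :=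
        div_le_div_of_nonneg_left hl (by norm_num) (by linarith)
      nlinarith
  have hlog2 := Real.log_two_gt_d9
  rw [kappaSum]
  refine (Finset.sum_le_sum hterm).trans ?_
  rw [Finset.sum_add_distrib, ← Finset.mul_sum, Finset.sum_ite_eq']
  have h5 : (if 2 ∈ P then (m : ℝ) / 4 * Real.log 2 else 0) ≤ m / 4 * Real.log 2 := by
    split_ifs
    · exact le_rfl
    · positivity
  linarith

theorem floorSum_add_two_le {m : ℕ} (hm : 2 ≤ m) : floorSum m + 2 ≤ m ^ 2 := by
  have h1 : floorSum m ≤ (m + 1) / 2 * (m / 2) := by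
    rw [floorSum]
    calc _ ≤ ((Finset.Icc 1 ((m + 1) / 2)).filter Nat.Prime).card * (m / 2) := by
          rw [← smul_eq_mul]
          refine Finset.sum_le_card_nsmul _ _ _ fun p hp => ?_
          have h2 := (Finset.mem_filter.mp hp).2.two_le
          have h3 : minFloor m p ≤ m / p := by simpa using minFloor_le p (Nat.zero_le m)
          exact h3.trans (Nat.div_le_div_left h2 (by norm_num))
      _ ≤ _ := by
          refine Nat.mul_le_mul_right _ ((Finset.card_filter_le _ _).trans ?_)
          rw [Nat.card_Icc]; omega
  have h2 : (m + 1) / 2 + m / 2 = m := by omega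
  have h3 : 1 ≤ (m + 1) / 2 := by omega
  have h4 : 1 ≤ m / 2 := by omega
  nlinarith

/-- With `ℓ = log n ≥ m (log m)² ≥ 19`, the claim follows from `m ≤ ℓ / 3.2` and
`ℓ² (ℓ + 1) ≤ 0.0005 e^ℓ`. -/
theorem sq_mul_log_le {m n : ℕ} (hm : 6 ≤ m) (hn : Real.exp (s m) ≤ (n : ℝ) - 1) :
    (m : ℝ) ^ 2 * Real.log (n + 1) ≤ 0.0000525 * n := by
  have h1 := log_ge_of_six_le hm
  have hmR : (6 : ℝ) ≤ m := by exact_mod_cast hm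
  have hn1 : 1 ≤ (n : ℝ) := by linarith [Real.exp_pos (s m)]
  have hs : s m ≤ Real.log n := by
    rw [Real.le_log_iff_exp_le (by linarith)]; linarith
  rw [s_of_five_le (by omega)] at hs
  set l := Real.log n with hl
  have hexp : Real.exp l = n := Real.exp_log (by linarith)
  have h2 : 3.2 ≤ Real.log m ^ 2 := by nlinarith
  have h3 : 3.2 * (m : ℝ) ≤ l := by nlinarith
  have hlog : Real.log (n + 1) ≤ l + 1 := by
    have h4 : Real.log ((n : ℝ) + 1) ≤ Real.log (Real.exp 1 * n) := by
      refine Real.log_le_log (by linarith) ?_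
      nlinarith [Real.exp_one_gt_two]
    rw [Real.log_mul (Real.exp_ne_zero 1) (by linarith), Real.log_exp] at h4
    linarith
  obtain ⟨t, ht⟩ : ∃ t, t = l - 19 := ⟨_, rfl⟩
  have ht0 : 0 ≤ t := by linarith
  have h19 : 170000000 ≤ Real.exp 19 := by
    have := le_exp_div (a := 170000000) (j := 19) (k := 1) (by norm_num) (by norm_num)
    norm_num at this ⊢
    exact this
  have ht3 : (1 + t / 3) ^ 3 ≤ Real.exp t := by
    have h5 : (1 + t / 3) ^ 3 ≤ Real.exp (t / 3) ^ 3 :=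
      pow_le_pow_left₀ (by positivity) (by linarith [Real.add_one_le_exp (t / 3)]) 3
    rwa [← Real.exp_nat_mul, show ((3 : ℕ) : ℝ) * (t / 3) = t by push_cast; ring] at h5
  have hbig : 170000000 * (1 + t / 3) ^ 3 ≤ n := by
    rw [← hexp, show l = 19 + t by rw [ht]; ring, Real.exp_add]
    exact mul_le_mul h19 ht3 (by positivity) (Real.exp_pos _).le
  have h6 : (m : ℝ) ^ 2 ≤ l ^ 2 / 10.24 := by
    rw [le_div_iff₀ (by norm_num)]; nlinarith
  have h7 : (m : ℝ) ^ 2 * Real.log (n + 1) ≤ l ^ 2 / 10.24 * (l + 1) :=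
    mul_le_mul h6 hlog (Real.log_nonneg (by linarith)) (by positivity)
  refine h7.trans (le_trans ?_ (mul_le_mul_of_nonneg_left hbig (by norm_num)))
  rw [show l = 19 + t by rw [ht]; ring, div_mul_eq_mul_div, div_le_iff₀ (by norm_num)]
  have ht2 : 0 ≤ t ^ 2 := by positivity
  have ht3 : 0 ≤ t ^ 3 := by positivity
  nlinarith

/-! ### The cases `m = 5` and `m ≥ 6` -/

theorem primes_Icc_three : (Finset.Icc 1 ((5 + 1) / 2)).filter Nat.Prime = {2, 3} := by decide

theorem floorSum_five : floorSum 5 = 3 := by decide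

theorem kappaSum_five : kappaSum 5 = 2 * Real.log 2 + 1 / 2 * Real.log 3 := by
  have h2 : minFloor 5 2 = 2 := by decide
  have h3 : minFloor 5 3 = 1 := by decide
  rw [kappaSum, primes_Icc_three, Finset.sum_pair (by norm_num), h2, h3]
  norm_num
  ring

theorem B_nonneg {m : ℕ} (hm : 5 ≤ m) (hd : 0 ≤ d m) : 0 ≤ B m := by
  have hmR : (5 : ℝ) ≤ m := by exact_mod_cast hm
  have h1 := B_sub_mul_d hm
  have h2 : Real.log m ≤ Real.log (m + 1) := Real.log_le_log (by linarith) (by linarith)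
  have h3 := log_ge_of_five_le hm
  rw [d_of_five_le hm] at hd
  have h4 : (0 : ℝ) ≤ m * d m := mul_nonneg (by linarith) (by rw [d_of_five_le hm]; exact hd)
  nlinarith

theorem kappa_mul_le {m : ℕ} (hm : 5 ≤ m) : kappa m * m ≤ kappaSum m := by
  have hmR : (5 : ℝ) ≤ m := by exact_mod_cast hm
  exact kappa_mul_le_kappaSum (by omega) (by nlinarith [sq_le_s_mul_exp hm])

theorem log_factorial_div_mul_exp (m : ℕ) :
    Real.log ((m ! : ℝ) / 120 * Real.exp ((82 : ℕ) / (29 : ℕ))) =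
      Real.log (m !) - Real.log 120 + 82 / 29 := by
  have h : (m ! : ℝ) ≠ 0 := Nat.cast_ne_zero.mpr (Nat.factorial_ne_zero m)
  rw [Real.log_mul (by positivity) (Real.exp_ne_zero _), Real.log_exp,
    Real.log_div h (by norm_num)]
  norm_num

theorem log_mul_exp_self {m : ℕ} (hm : 1 ≤ m) :
    Real.log ((m : ℝ) * Real.exp m) = Real.log m + m := by
  rw [Real.log_mul (Nat.cast_ne_zero.mpr (by omega)) (Real.exp_ne_zero _), Real.log_exp]

section

variable {K : Type*} [Field K] [NumberField K] [NumberField.IsTotallyComplex K]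

theorem lower_bound_five (hK : Module.finrank ℚ K = 2) (ψ : K →+* ℂ) {H : ℝ} (hH0 : 0 < H)
    (hH : s 5 * Real.exp (s 5) ≤ Real.log H)
    {lam : Fin (5 + 1) → NumberField.RingOfIntegers K} (hlam : lam ≠ 0)
    (hlamH : ∀ j : Fin (5 + 1), j ≠ 0 → ‖ψ (lam j)‖ ≤ H) :
    1 / (2 * Real.exp (D 5)) * (2 * H) ^ (-((5 : ℕ) : ℝ) - eps 5 H)
      < ‖∑ j : Fin (5 + 1), ψ (lam j) * Complex.exp 1 ^ (j : ℕ)‖ := by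
  have hlog2u := Real.log_two_lt_d9
  have hlog2l := Real.log_two_gt_d9
  have hlog3u := Real.log_three_lt_d9
  have hlog3l := Real.log_three_gt_d9
  have hlog5u := Real.log_five_lt_d9
  have hlog5l := Real.log_five_gt_d9
  have hs : s 5 = 5 * Real.log 5 ^ 2 := by rw [s_of_five_le le_rfl]; norm_num
  have hsl : 12.95 ≤ s 5 := by rw [hs]; nlinarith
  have hsu : s 5 ≤ 12.952 := by rw [hs]; nlinarith
  have hk := kappa_mul_le (m := 5) le_rfl
  have hd : d 5 = 5.5 * Real.log 5 - 5 - kappa 5 * (5 : ℕ) - 0.02394 := by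
    rw [d_of_five_le le_rfl]; push_cast; ring
  have hdl : 1.8923 ≤ d 5 := by
    rw [hd]; rw [kappaSum_five] at hk; norm_num at hk ⊢; linarith
  have hds := d_lt_s (m := 5) le_rfl
  have hlog6 : Real.log ((5 : ℕ) + 1) = Real.log 2 + Real.log 3 := by
    rw [← log_six]; norm_num
  have hBd : B 5 - (5 : ℕ) * d 5 =
      6 * (Real.log 2 + Real.log 3) - 5 - kappa 5 * (5 : ℕ) + 0.0000525 := by
    rw [B_sub_mul_d le_rfl, hlog6]; push_cast; ring
  have hexps : 400000 ≤ Real.exp (s 5) := by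
    have h1 : (400000 : ℝ) ≤ Real.exp ((129 : ℕ) / (10 : ℕ)) :=
      le_exp_div (by norm_num) (by norm_num)
    refine h1.trans (Real.exp_le_exp.mpr ?_)
    norm_num at hsl ⊢; linarith
  have hlog120 : Real.log 120 = 3 * Real.log 2 + Real.log 3 + Real.log 5 := by
    rw [show (120 : ℝ) = 2 ^ 3 * 3 * 5 by norm_num, Real.log_mul (by norm_num) (by norm_num),
      Real.log_mul (by norm_num) (by norm_num), Real.log_pow]
    norm_num
  have hlogM := log_factorial_div_mul_exp 5
  rw [show ((5 ! : ℕ) : ℝ) = 120 by norm_num [Nat.factorial]] at hlogM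
  have hlogA : Real.log (((5 : ℕ) : ℝ) ^ 5) = 5 * Real.log 5 := by
    rw [Real.log_pow]; push_cast; ring
  have h450001 : (450001 : ℝ) ≤ Real.exp 13.1 := by
    have h1 : (450001 : ℝ) ≤ Real.exp ((131 : ℕ) / (10 : ℕ)) :=
      le_exp_div (by norm_num) (by norm_num)
    rwa [show (((131 : ℕ) : ℝ) / (10 : ℕ)) = 13.1 by norm_num] at h1
  -- Here `log (n - 1) > s 5` on the range of `n`, which makes the factor `1.0005` possible; with the
  -- factor `1` the comparison with the claimed bound would not follow.
  refine lower_bound_of_parameters hK ψ (by norm_num) hH0 hH hlam hlamH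
    (M := (5 ! : ℝ) / 120 * Real.exp ((82 : ℕ) / (29 : ℕ)))
    (A := (5 : ℕ) ^ 5) (E := (5 : ℕ) * Real.exp (5 : ℕ)) (d' := d 5) (r := 1.0005)
    (n₀ := 450000) (by positivity) (by norm_num) (by positivity) (by norm_num)
    (fun x hx hx5 => abs_prod_le_factorial le_rfl hx hx5)
    (fun k hk x hx hx2 => abs_prod_erase_le k hk hx hx2) (sum_exp_sub_one_le 5)
    (by linarith) hds (B_nonneg le_rfl (by linarith)) (add_B_sub_mul_d_eq_D le_rfl).le
    (by norm_num) ?_ ?_ ?_ ?_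
  · intro n hn
    refine ⟨?_, ?_⟩
    · have hT : 5100000 ≤ s 5 * Real.exp (s 5) := by nlinarith
      refine le_of_le_mul_log_sub hn (by linarith)
        (le_trans (by norm_num) h450001) ?_
      norm_num
      linarith
    · refine exp_le_sub_one_of_le_mul_log_sub (by linarith) hn ?_
      have h1 : Real.exp (-s 5) ≤ 1 := Real.exp_le_one_iff.mpr (by linarith)
      nlinarith
  · intro n hn _
    have hn' : (450000 : ℝ) ≤ n := by exact_mod_cast hn
    have h2 := log_le_tangent (t := (n : ℝ)) (by norm_num) h450001 (by linarith)
    have h3 := log_le_tangent (t := (n : ℝ) + 1) (by norm_num) h450001 (by linarith)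
    have h4 : 0.00038 ≤ d 5 - 1 - 82 / 29 + kappaSum 5 := by
      rw [hd]; norm_num at hk ⊢; linarith
    have h5 := mul_le_mul_of_nonneg_right h4 (by linarith : (0 : ℝ) ≤ n)
    rw [floorSum_five, log_mul_exp_self (by norm_num), hlogA,
      show ((5 ! : ℕ) : ℝ) = 120 by norm_num [Nat.factorial], hlogM]
    norm_num at h2 h3 h5 ⊢
    linarith
  · intro n hn _
    have hn' : (449999 : ℝ) ≤ n - 1 := by
      have : (450000 : ℝ) ≤ n := by exact_mod_cast hn
      linarith
    have h1 : 13 ≤ Real.log ((n : ℝ) - 1) := by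
      rw [Real.le_log_iff_exp_le (by linarith)]
      have h2 := exp_div_le (a := 449999) (j := 13) (k := 1) (by norm_num) (by norm_num)
        (by norm_num)
      norm_num at h2
      linarith
    have h2 : Real.log (1.0005 : ℝ) ≤ 0.0005 := by
      have := Real.log_le_sub_one_of_pos (show (0 : ℝ) < 1.0005 by norm_num)
      norm_num at this ⊢; linarith
    set l := Real.log ((n : ℝ) - 1) with hl
    have h3 : d 5 * 0.0772 ≤ d 5 / s 5 := by
      rw [le_div_iff₀ (by linarith), mul_assoc]
      exact mul_le_of_le_one_right (by linarith) (by linarith)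
    have h4 : d 5 / s 5 ≤ 1 := by rw [div_le_one (by linarith)]; exact hds.le
    obtain ⟨q, hq⟩ : ∃ q, q = 1.0005 * (l + 0.0005) * 0.0772 - 1 := ⟨_, rfl⟩
    have h5 : 0 ≤ q := by rw [hq]; linarith only [h1]
    have h6 : 1.8923 * q ≤ d 5 * q := mul_le_mul_of_nonneg_right hdl h5
    have h7 : 1.0005 * (l + 0.0005) - l ≤ 1.8923 * q := by rw [hq]; linarith only [h1]
    calc 1.0005 * (l + Real.log 1.0005) * (1 - d 5 / s 5)
        ≤ 1.0005 * (l + 0.0005) * (1 - d 5 / s 5) :=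
          mul_le_mul_of_nonneg_right (by linarith only [h2]) (by linarith only [h4])
      _ ≤ 1.0005 * (l + 0.0005) * (1 - d 5 * 0.0772) :=
          mul_le_mul_of_nonneg_left (by linarith only [h3]) (by linarith only [h1])
      _ = 1.0005 * (l + 0.0005) - d 5 - d 5 * q := by rw [hq]; ring
      _ ≤ l - d 5 := by linarith only [h6, h7]
  · intro n hn _
    have hn' : (450000 : ℝ) ≤ n := by exact_mod_cast hn
    have h3 := log_le_tangent (t := (n : ℝ) + 1) (by norm_num) h450001 (by linarith)
    have h4 : 0 ≤ Real.log (1.0005 : ℝ) := Real.log_nonneg (by norm_num)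
    have hB9 : 9 ≤ B 5 := by
      norm_num at hBd hk
      rw [kappaSum_five] at hk
      linarith
    have h5 : (((5 : ℕ) : ℝ) * d 5 + ((((5 : ℕ) : ℝ) + 1) * (Real.log 2 + Real.log 3) - (5 : ℕ)
        - kappaSum 5) - B 5 * 1.0005) * ((n : ℝ) - 1) ≤ -0.0045 * (n - 1) := by
      refine mul_le_mul_of_nonneg_right ?_ (by linarith)
      norm_num at hBd hk ⊢
      linarith
    rw [floorSum_five, hlog6]
    norm_num at h3 h4 h5 hBd hk ⊢
    linarith

theorem lower_bound_of_six_le (hK : Module.finrank ℚ K = 2) (ψ : K →+* ℂ) {m : ℕ} (hm : 6 ≤ m)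
    {H : ℝ} (hH0 : 0 < H) (hH : s m * Real.exp (s m) ≤ Real.log H)
    {lam : Fin (m + 1) → NumberField.RingOfIntegers K} (hlam : lam ≠ 0)
    (hlamH : ∀ j : Fin (m + 1), j ≠ 0 → ‖ψ (lam j)‖ ≤ H) :
    1 / (2 * Real.exp (D m)) * (2 * H) ^ (-(m : ℝ) - eps m H)
      < ‖∑ j : Fin (m + 1), ψ (lam j) * Complex.exp 1 ^ (j : ℕ)‖ := by
  have hm5 : 5 ≤ m := by omega
  have hlog2u := Real.log_two_lt_d9
  have hlog2l := Real.log_two_gt_d9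
  have hlog3l := Real.log_three_gt_d9
  have hmR : (6 : ℝ) ≤ m := by exact_mod_cast hm
  have hlm := log_ge_of_six_le hm
  have hk := kappa_mul_le hm5
  have hsl := mul_le_s hm5
  have hfacu := log_factorial_le (n := m) (by omega)
  have hd := d_of_five_le hm5
  have hd1 : 1 ≤ d m := by
    have h1 := kappaSum_le m
    rw [hd]
    nlinarith
  have hBd := B_sub_mul_d hm5
  have hlogM := log_factorial_div_mul_exp m
  have hlogA : Real.log ((m : ℝ) ^ m) = m * Real.log m := Real.log_pow _ _
  have hfac6 : 0.003 ≤ (m + 1 / 2) * Real.log m - m - 0.02394 - 1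
      - (Real.log (m !) - Real.log 120 + 82 / 29) := by
    -- `m! / (√(2m) (m/e)^m)` decreases, so that it suffices to consider `m = 6`
    have h1 := Stirling.log_stirlingSeq'_antitone (show 5 ≤ m - 1 by omega)
    simp only [Function.comp_apply, Nat.succ_eq_add_one, show m - 1 + 1 = m by omega] at h1
    have hm0 : (m : ℝ) ≠ 0 := by positivity
    rw [Stirling.log_stirlingSeq_formula, Stirling.log_stirlingSeq_formula,
      Real.log_mul two_ne_zero hm0, Real.log_div hm0 (Real.exp_ne_zero 1), Real.log_exp] at h1
    have h720 : Real.log (((5 + 1)! : ℕ) : ℝ) = Real.log 6 + Real.log 120 := by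
      rw [← Real.log_mul (by norm_num) (by norm_num)]
      norm_num [Nat.factorial]
    rw [h720] at h1
    push_cast at h1
    rw [Real.log_mul two_ne_zero (by norm_num),
      Real.log_div (by norm_num) (Real.exp_ne_zero 1), Real.log_exp] at h1
    have h6 : 1.79175946 ≤ Real.log 6 := by rw [log_six]; linarith
    norm_num at h6 ⊢
    linarith
  have hexp3 : s m + 1 ≤ Real.exp (s m) := Real.add_one_le_exp _
  have hfacl := Stirling.le_log_factorial_stirling (n := m) (by omega)
  have hfs : (floorSum m : ℝ) + 2 ≤ (m : ℝ) ^ 2 := by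
    exact_mod_cast floorSum_add_two_le (by omega : 2 ≤ m)
  refine lower_bound_of_parameters hK ψ (by omega) hH0 hH hlam hlamH
    (M := (m ! : ℝ) / 120 * Real.exp ((82 : ℕ) / (29 : ℕ)))
    (A := (m : ℝ) ^ m) (E := (m : ℝ) * Real.exp m) (d' := d m) (r := 1)
    (n₀ := 3) (by positivity) (by positivity) (by positivity) (by norm_num)
    (fun x hx hxm => abs_prod_le_factorial hm5 hx hxm)
    (fun k hk x hx hx2 => abs_prod_erase_le k hk hx hx2) (sum_exp_sub_one_le m)
    (by linarith) (d_lt_s hm5) (B_nonneg hm5 (by linarith)) (add_B_sub_mul_d_eq_D hm5).le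
    (by norm_num) ?_ ?_ ?_ ?_
  · intro n hn
    have h1 : Real.exp (s m) ≤ n - 1 := by
      refine exp_le_sub_one_of_le_mul_log_sub (by linarith) hn ?_
      have h1 : Real.exp (-s m) ≤ 1 := Real.exp_le_one_iff.mpr (by linarith)
      nlinarith
    refine ⟨?_, h1⟩
    have h2 : (3 : ℝ) ≤ n := by linarith
    exact_mod_cast h2
  · intro n hn hx
    have h1 := sq_mul_log_le hm hx
    have hn' : (3 : ℝ) ≤ n := by exact_mod_cast hn
    have hsn : s m ≤ Real.log (n + 1) := by
      rw [Real.le_log_iff_exp_le (by linarith)]; linarith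
    have hnn : Real.log n ≤ Real.log (n + 1) := Real.log_le_log (by linarith) (by linarith)
    have hmm : Real.log m ≤ m - 1 := Real.log_le_sub_one_of_pos (by linarith)
    have h2 : ((floorSum m : ℝ) + 2) * Real.log (n + 1) ≤ 0.0000525 * n :=
      (mul_le_mul_of_nonneg_right hfs (by linarith)).trans h1
    have h3 : 0.003 ≤ d m - 1 - (Real.log (m !) - Real.log 120 + 82 / 29) + kappaSum m := by
      rw [hd]; linarith
    have h4 := mul_le_mul_of_nonneg_right h3 (by linarith : (0 : ℝ) ≤ n)
    have hlog120 : Real.log 120 ≤ 4.8 := by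
      rw [Real.log_le_iff_le_exp (by norm_num)]
      have := le_exp_div (a := 120) (j := 24) (k := 5) (by norm_num) (by norm_num)
      norm_num at this ⊢
      exact this
    rw [log_mul_exp_self (by omega), hlogA, hlogM]
    norm_num at h2 h4 hlog120 hsl ⊢
    linarith [log_two_pi_ge]
  · intro n _ hx
    exact log_mul_one_sub_div_le (by linarith) (by linarith) hx
  · intro n hn hx
    have h1 := sq_mul_log_le hm hx
    have hn' : (3 : ℝ) ≤ n := by exact_mod_cast hn
    have h2 : (floorSum m : ℝ) * Real.log (n + 1) ≤ 0.0000525 * n :=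
      (mul_le_mul_of_nonneg_right (by linarith) (Real.log_nonneg (by linarith))).trans h1
    have h3 : Real.log m ≤ Real.log (m + 1) := Real.log_le_log (by linarith) (by linarith)
    have h4 := mul_le_mul_of_nonneg_right hk (by linarith : (0 : ℝ) ≤ n)
    have hB : B m = m * d m + ((m + 1) * Real.log (m + 1) - (1 + kappa m) * m + 0.0000525) := by
      linarith
    rw [Real.log_one, hB]
    norm_num at h2 ⊢
    linarith

end

end TranscendenceE

theorem theorem2p1 (K : Type*) [Field K] [NumberField K] [NumberField.IsTotallyComplex K]
    (hK : Module.finrank ℚ K = 2) (φ : K →+* ℂ)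
    (m : ℕ) (hm : 2 ≤ m) (H : ℝ) (hH0 : 0 < H)
    (hH : TranscendenceE.s m * Real.exp (TranscendenceE.s m) ≤ Real.log H)
    (lam : Fin (m + 1) → NumberField.RingOfIntegers K) (hlam : lam ≠ 0)
    (hlamH : ∀ j : Fin (m + 1), j ≠ 0 → ‖φ (lam j)‖ ≤ H) :
    1 / (2 * Real.exp (TranscendenceE.D m)) * (2 * H) ^ (-(m : ℝ) - TranscendenceE.eps m H)
      < ‖∑ j : Fin (m + 1), φ (lam j) * Complex.exp 1 ^ (j : ℕ)‖ := by
  obtain rfl | rfl | rfl | rfl | h6 : m = 2 ∨ m = 3 ∨ m = 4 ∨ m = 5 ∨ 6 ≤ m := by omega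
  · exact TranscendenceE.lower_bound_two hK φ hH0 hH hlam hlamH
  · exact TranscendenceE.lower_bound_three hK φ hH0 hH hlam hlamH
  · exact TranscendenceE.lower_bound_four hK φ hH0 hH hlam hlamH
  · exact TranscendenceE.lower_bound_five hK φ hH0 hH hlam hlamH
  · exact TranscendenceE.lower_bound_of_six_le hK φ h6 hH0 hH hlam hlamH
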